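/- **Setting.** Let $R_0>0$, $L=4R_0$, $\Omega=[0,L]^3$, $\nu>0$. Let $\|\cdot\|$, $(\cdot,\cdot)$ be the norm and inner product of $L^2(\Omega)^3$, $H$ the space of $\Omega$-periodic, divergence-free fields in $L^2(\Omega)^3$ with zero average, $A=-\Delta$ the Stokes operator on $H$ (with powers $A^s$ defined through Fourier series), $V=D(A^{1/2})$, and $(B(w,v),w)=\int_\Omega (w\cdot\nabla v)\cdot w$. Let $f\in V$, $f\ne 0$, be a time-independent force. A *Leray–Hopf solution* on $I=[0,\infty)$ or $I=\mathbb R$ is a weakly continuous $u:I\to H$ with $u\in L^\infty(I,H)\cap L^2_{loc}(I,V)$ such that for every $v\in V$, in the sense of distributions in time, $\frac{d}{dt}(u,v)+\nu(A^{1/2}u,A^{1/2}v)-(B(u,v),u)=(f,v)$, and such that for almost every $t_0\in I$ and all $t_1\ge t_0$, $$\nu\int_{t_0}^{t_1}\|A^{1/2}u\|^2\,dt\le \tfrac12\|u(t_0)\|^2-\tfrac12\|u(t_1)\|^2+\int_{t_0}^{t_1}(f,u)\,dt .$$ The *weak attractor* $\mathcal A_w\subset H$ is the set of all values of Leray–Hopf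 solutions on $\mathbb R$. Let $C_0>0$, $\delta\in(1/2,1)$, $T>0$, and let $\eta\in C^1(\mathbb R)$ satisfy $0\le\eta\le1$, $\operatorname{supp}\eta\subset[0,T]$, $|\eta'|\le \frac{C_0}{T}\eta^\delta$ and $c_\eta:=\frac1T\int_0^T\eta\,dt>0$. For a Leray–Hopf solution $u$ on $[0,\infty)$ put $$e_0=\frac1{TR_0^3}\int_0^T\eta^\delta\,\frac{\|u\|^2}2\,dt,\qquad \varepsilon_0=\frac{\nu}{TR_0^3}\int_0^T\eta\,\|A^{1/2}u\|^2\,dt+\varepsilon_\infty,$$ where the anomalous dissipation $\varepsilon_\infty$ is determined by the energy balance $\varepsilon_0=\frac1{TR_0^3}\int_0^T\eta'\,\frac{\|u\|^2}2\,dt+\frac1{TR_0^3}\int_0^T\eta\,(f,u)\,dt$. Let $C_A>0$ be any constant in the Agmon inequality $\|w\|_\infty\le C_A\|A^{1/2}w\|^{1/2}\|Aw\|^{1/2}$ for $w\in D(A)$ (such a constant exists and can be chosen independently of $L$), and put $$\gamma_f=\frac{C_0}{\nu T}\frac{\|A^{-1}f\|}{\|f\|}+1,\quad \sigma_f=\frac{2\gamma_f^2\nu^2}{c_\eta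 C_A}\frac{\|f\|^{1/2}}{\|A^{1/2}f\|^{1/2}}\frac{\|f\|^2}{\|A^{-1/2}f\|^2},\quad \theta_f=\frac{c_\eta}{4C_A}\frac1{R_0^{5/2}}\frac{\|A^{-1/2}f\|^2}{\|f\|^{3/2}\|A^{1/2}f\|^{1/2}} .$$ **Theorem 5.** Let $u$ be a Leray–Hopf solution on $[0,\infty)$ with $u(t)\in\mathcal A_w$ for all $t\in[0,T]$, and assume $$\|f\|\ge\sigma_f,\qquad T\ge\frac{2C_0}{\pi^2}\frac{R_0^2}{\nu},$$ and, for some $K>0$, $K\,e_0^{3/2}/R_0\le\varepsilon_0$. Then $\varepsilon_\infty\ge0$ and $$\frac{K^{3/2}\theta_f^{3/2}}{8^{1/4}}\frac{\|f\|}{R_0^{3/2}}\,e_0^{1/2}\le\varepsilon_0\le2\sqrt2\,\frac{\|f\|}{R_0^{3/2}}\,e_0^{1/2},$$ $$\theta_f\frac{\|f\|}{R_0^{1/2}}\le e_0\le\frac{2\sqrt2}{K}\frac{\|f\|}{R_0^{1/2}},$$ $$K\theta_f^{3/2}\frac{\|f\|^{3/2}}{R_0^{7/4}}\le\varepsilon_0\le\frac{8^{5/4}}{K^{3/2}\theta_f}\frac{\|f\|^{3/2}}{R_0^{7/4}}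 .$$ In terms of the Grashof number $\mathrm{Gr}=\|f\|/(\nu^2R_0^{-3/2})$, the last two lines read $$\theta_f\frac{\nu^2}{R_0^2}\mathrm{Gr}\le e_0\le\frac{2\sqrt2}{K}\frac{\nu^2}{R_0^2}\mathrm{Gr},\qquad K\theta_f^{3/2}\frac{\nu^3}{R_0^4}\mathrm{Gr}^{3/2}\le\varepsilon_0\le\frac{8^{5/4}}{K^{3/2}\theta_f}\frac{\nu^3}{R_0^4}\mathrm{Gr}^{3/2}.$$ -/

import Mathlib

open MeasureTheory Set
open scoped ContDiff ENNReal

noncomputable section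

/-- The periodic box of side `L`: the torus obtained from `[0, L]^3` by identifying opposite
faces. Its volume measure is Lebesgue measure, of total mass `L ^ 3`. -/
abbrev Box (L : ℝ) : Type := Fin 3 → AddCircle L

/-- Square-integrable `L`-periodic vector fields on three-dimensional space. -/
abbrev Field2 (L : ℝ) [Fact (0 < L)] : Type :=
  Lp (EuclideanSpace ℝ (Fin 3)) 2 (volume : Measure (Box L))

/-- The character `x ↦ exp (2 π i k · x / L)`. -/
def boxChar (L : ℝ) (k : Fin 3 → ℤ) (x : Box L) : ℂ :=
  ∏ i, fourier (k i) (x i)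

/-- Fourier coefficient of the `j`-th component of `v` at the frequency `k`, normalised so that
`v = ∑ k, (fcoef L v k) * boxChar L k`. -/
def fcoef (L : ℝ) [Fact (0 < L)] (v : Field2 L) (k : Fin 3 → ℤ) (j : Fin 3) : ℂ :=
  ((1 / L ^ 3 : ℝ) : ℂ) * ∫ x : Box L, boxChar L (-k) x * ((v x j : ℝ) : ℂ)

/-- The space `H`: square-integrable periodic fields that are divergence-free
(in the sense of distributions) and have zero average. -/
def spaceH (L : ℝ) [Fact (0 < L)] : Set (Field2 L) :=
  {v | (∀ k : Fin 3 → ℤ, ∑ j, (k j : ℂ) * fcoef L v k j = 0) ∧ ∫ x : Box L, v x = 0}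

/-- Eigenvalue of `A = -Δ` at the frequency `k`. -/
def stokesEig (L : ℝ) (k : Fin 3 → ℤ) : ℝ :=
  (2 * Real.pi / L) ^ 2 * ∑ i, (k i : ℝ) ^ 2

/-- The inner product `(A ^ s v, A ^ s w)`, where `A ^ s` multiplies the coefficient at `k` by
the `s`-th power of the eigenvalue. (Elements of `H` have no coefficient at `k = 0`.) -/
def stokesInner (L : ℝ) [Fact (0 < L)] (s : ℝ) (v w : Field2 L) : ℝ :=
  L ^ 3 * ∑' k : Fin 3 → ℤ, stokesEig L k ^ (2 * s) *
    ∑ j, (fcoef L v k j * (starRingEnd ℂ) (fcoef L w k j)).re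

/-- The norm `‖A ^ s v‖`. -/
def stokesNorm (L : ℝ) [Fact (0 < L)] (s : ℝ) (v : Field2 L) : ℝ :=
  Real.sqrt (stokesInner L s v v)

/-- The domain `D(A ^ s)` of the power `A ^ s` in `H`. -/
def stokesDomain (L : ℝ) [Fact (0 < L)] (s : ℝ) : Set (Field2 L) :=
  {v | v ∈ spaceH L ∧
    Summable (fun k : Fin 3 → ℤ => stokesEig L k ^ (2 * s) * ∑ j, ‖fcoef L v k j‖ ^ 2)}

/-- The space `V = D(A ^ (1/2))`. -/
def spaceV (L : ℝ) [Fact (0 < L)] : Set (Field2 L) := stokesDomain L (1 / 2)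

/-- `G i` is the weak derivative of `v` in the direction of the `i`-th coordinate
(tested against all characters). -/
def IsWeakGradient (L : ℝ) [Fact (0 < L)] (v : Field2 L) (G : Fin 3 → Field2 L) : Prop :=
  ∀ (k : Fin 3 → ℤ) (i j : Fin 3),
    fcoef L (G i) k j = (2 * Real.pi * Complex.I * (k i : ℂ) / (L : ℂ)) * fcoef L v k j

/-- The trilinear expression `(B(w, v), w) = ∫ (w · ∇ v) · w`, where `G = ∇ v`. -/
def trilinear (L : ℝ) [Fact (0 < L)] (w : Field2 L) (G : Fin 3 → Field2 L) : ℝ :=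
  ∫ x : Box L, ∑ i, ∑ j, w x i * G i x j * w x j

/-- Leray-Hopf weak solutions of the space-periodic Navier-Stokes equations with viscosity `ν` and
time-independent force `f` on the time interval `I`, which is `[0, ∞)` or the whole line. -/
structure IsLerayHopf (L : ℝ) [Fact (0 < L)] (ν : ℝ) (f : Field2 L) (I : Set ℝ)
    (u : ℝ → Field2 L) : Prop where
  /-- The values are in `H`. -/
  mem_H : ∀ t ∈ I, u t ∈ spaceH L
  /-- `u` is essentially bounded with values in `H`. -/
  bounded : MemLp u ∞ (volume.restrict I)
  /-- `u` is the weakly continuous representative. -/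
  weak_cont : ∀ v : Field2 L, ContinuousOn (fun t => inner ℝ (u t) v) I
  /-- `u` is locally square-integrable in time with values in `V`. -/
  mem_V : ∀ᵐ t ∂(volume.restrict I), u t ∈ spaceV L
  sq_int : LocallyIntegrableOn (fun t => stokesNorm L (1 / 2) (u t) ^ 2) I volume
  /-- For every `v` in `V`, in the sense of distributions in time,
  `d/dt (u, v) + ν (A^(1/2) u, A^(1/2) v) - (B(u, v), u) = (f, v)`. -/
  weak_form : ∀ v ∈ spaceV L, ∀ G : Fin 3 → Field2 L, IsWeakGradient L v G →
    ∀ φ : ℝ → ℝ, ContDiff ℝ ∞ φ → HasCompactSupport φ → tsupport φ ⊆ interior I →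
      ∫ t, (-(deriv φ t * inner ℝ (u t) v) +
        φ t * (ν * stokesInner L (1 / 2) (u t) v - trilinear L (u t) G - inner ℝ f v)) = 0
  /-- The energy inequality, for almost every `t₀` and all `t₁ ≥ t₀`. -/
  energy_ineq : ∀ᵐ t₀ ∂(volume.restrict I), ∀ t₁ : ℝ, t₀ ≤ t₁ →
    ν * ∫ t in t₀..t₁, stokesNorm L (1 / 2) (u t) ^ 2 ≤
      ‖u t₀‖ ^ 2 / 2 - ‖u t₁‖ ^ 2 / 2 + ∫ t in t₀..t₁, inner ℝ f (u t)

/-- The weak global attractor: the set of all values of Leray-Hopf solutions that are defined (and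
bounded in `H`) for all positive and negative times. The equation being autonomous, it is enough
to take the values at time `0`. -/
def weakAttractor (L : ℝ) [Fact (0 < L)] (ν : ℝ) (f : Field2 L) : Set (Field2 L) :=
  {v | ∃ w : ℝ → Field2 L, IsLerayHopf L ν f univ w ∧ w 0 = v}

/-- Refined time cut-offs on `[0, T]` with parameters `C₀` and `δ`. -/
structure IsTimeCutoff (C₀ δ T : ℝ) (η : ℝ → ℝ) : Prop where
  contDiff : ContDiff ℝ 1 η
  nonneg : ∀ t, 0 ≤ η t
  le_one : ∀ t, η t ≤ 1
  supp : tsupport η ⊆ Icc 0 T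
  deriv_le : ∀ t, |deriv η t| ≤ C₀ / T * η t ^ δ

/-- `C_A` is a constant in the Agmon inequality
`‖w‖_∞ ≤ C_A ‖A^(1/2) w‖^(1/2) ‖A w‖^(1/2)` on `D(A)`. -/
def IsAgmonConstant (L : ℝ) [Fact (0 < L)] (C_A : ℝ) : Prop :=
  0 < C_A ∧ ∀ w ∈ stokesDomain L 1, ∀ᵐ x : Box L,
    ‖w x‖ ≤ C_A * stokesNorm L (1 / 2) w ^ (1 / 2 : ℝ) * stokesNorm L 1 w ^ (1 / 2 : ℝ)

/-- The time-averaged global kinetic energy `e₀`. -/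
def meanEnergy (L : ℝ) [Fact (0 < L)] (R₀ δ T : ℝ) (η : ℝ → ℝ) (u : ℝ → Field2 L) : ℝ :=
  1 / T * (1 / R₀ ^ 3) * ∫ t in (0 : ℝ)..T, η t ^ δ * (‖u t‖ ^ 2 / 2)

/-- The time-averaged viscous dissipation rate. -/
def viscousDissipation (L : ℝ) [Fact (0 < L)] (ν R₀ T : ℝ) (η : ℝ → ℝ) (u : ℝ → Field2 L) : ℝ :=
  1 / T * (1 / R₀ ^ 3) * ν * ∫ t in (0 : ℝ)..T, η t * stokesNorm L (1 / 2) (u t) ^ 2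

/-- The anomalous dissipation rate: the defect in the energy balance localised in time by `η`. -/
def anomalousDissipation (L : ℝ) [Fact (0 < L)] (ν R₀ T : ℝ) (f : Field2 L) (η : ℝ → ℝ)
    (u : ℝ → Field2 L) : ℝ :=
  1 / T * (1 / R₀ ^ 3) * (∫ t in (0 : ℝ)..T, deriv η t * (‖u t‖ ^ 2 / 2)) +
    1 / T * (1 / R₀ ^ 3) * (∫ t in (0 : ℝ)..T, η t * inner ℝ f (u t)) -
      viscousDissipation L ν R₀ T η u

/-- The total (viscous and anomalous) dissipation rate `ε₀`. -/
def meanDissipation (L : ℝ) [Fact (0 < L)] (ν R₀ T : ℝ) (f : Field2 L) (η : ℝ → ℝ)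
    (u : ℝ → Field2 L) : ℝ :=
  viscousDissipation L ν R₀ T η u + anomalousDissipation L ν R₀ T f η u

/-- The average `c_η` of the cut-off. -/
def cutoffMean (T : ℝ) (η : ℝ → ℝ) : ℝ := 1 / T * ∫ t in (0 : ℝ)..T, η t

/-- The factor `γ_f`. -/
def gammaFactor (L : ℝ) [Fact (0 < L)] (ν C₀ T : ℝ) (f : Field2 L) : ℝ :=
  C₀ / (ν * T) * (stokesNorm L (-1) f / ‖f‖) + 1

/-- The threshold `σ_f` for the size of the force. -/
def sigmaFactor (L : ℝ) [Fact (0 < L)] (ν C₀ C_A T : ℝ) (η : ℝ → ℝ) (f : Field2 L) : ℝ :=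
  2 * gammaFactor L ν C₀ T f ^ 2 * ν ^ 2 / (cutoffMean T η * C_A) *
    (‖f‖ ^ (1 / 2 : ℝ) / stokesNorm L (1 / 2) f ^ (1 / 2 : ℝ)) *
      (‖f‖ ^ 2 / stokesNorm L (-(1 / 2)) f ^ 2)

/-- The shape factor `θ_f` of the force. -/
def thetaFactor (L : ℝ) [Fact (0 < L)] (R₀ C_A T : ℝ) (η : ℝ → ℝ) (f : Field2 L) : ℝ :=
  cutoffMean T η / (4 * C_A) * (1 / R₀ ^ (5 / 2 : ℝ)) *
    (stokesNorm L (-(1 / 2)) f ^ 2 /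
      (‖f‖ ^ (3 / 2 : ℝ) * stokesNorm L (1 / 2) f ^ (1 / 2 : ℝ)))

/-- The Grashof number in the periodic setting. -/
def grashof (L : ℝ) [Fact (0 < L)] (ν R₀ : ℝ) (f : Field2 L) : ℝ :=
  ‖f‖ / (ν ^ 2 * R₀ ^ (-(3 / 2) : ℝ))

end

/-! Two inequalities between `e₀` and `ε₀` carry the theorem; the hypothesis `K e₀^(3/2) / R₀ ≤ ε₀`
closes the system, and what remains is algebra (`scaling_of_roots`).

Upper bound of `ε₀`. The energy balance writes `ε₀` through `∫ η' ‖u‖²/2` and `∫ η (f, u)`. With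
`|η'| ≤ (C₀/T) η^δ`, `η ≤ η^δ` and Cauchy-Schwarz this is at most `(C₀/T) e₀ + √2 ‖f‖ R₀^(-3/2)
e₀^(1/2)`. On the weak attractor `‖u‖` is at most `‖f‖ / (ν λ₁)`, with `λ₁` the first Stokes
eigenvalue (`norm_le_of_mem_weakAttractor`), and the lower bound on `T` then puts the first term
under the second (`dissipation_le_of_flux_bound`).

Lower bound of `e₀`. The equation is tested with `A⁻¹ f` and `η`. The force contributes `c_η
‖A^(-1/2) f‖²`; the other side is at most `g a + D s`, where `a` and `s` are the `η^δ`-weighted time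
means of `‖u‖` and `‖u‖²`, and `D` bounds `∇ A⁻¹ f` pointwise by Agmon's inequality
(`IsLerayHopf.integral_cutoff_mul_force_le`). The condition `‖f‖ ≥ σ_f` keeps the linear term from
dominating, which leaves `s ≥ c_η ‖A^(-1/2) f‖² / (2 D)` (`ratio_le_of_tested_equation`).

The sign of `ε_∞` is the energy inequality integrated against `η` (`localized_energy_le`). Agmon's
inequality with a constant independent of `L` comes from summing Fourier coefficients with a weight
and a lattice-point count (`sum_lattice_le`). -/

/-! ### Characters of the torus as a Hilbert basis of `L²`. -/

section Characters

open scoped ComplexConjugate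

variable {L : ℝ}

/-- The character `boxChar L k` as a continuous function. -/
noncomputable def boxCharC (L : ℝ) (k : Fin 3 → ℤ) : C(Box L, ℂ) where
  toFun := boxChar L k
  continuous_toFun := by unfold boxChar; fun_prop

@[simp] lemma boxCharC_apply (k : Fin 3 → ℤ) (x : Box L) : boxCharC L k x = boxChar L k x := rfl

lemma boxChar_neg (k : Fin 3 → ℤ) (x : Box L) : boxChar L (-k) x = conj (boxChar L k x) := by
  simp only [boxChar, Pi.neg_apply, fourier_neg, map_prod]

lemma boxChar_add (k l : Fin 3 → ℤ) (x : Box L) :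
    boxChar L (k + l) x = boxChar L k x * boxChar L l x := by
  simp only [boxChar, Pi.add_apply, fourier_add, ← Finset.prod_mul_distrib]

@[simp] lemma boxChar_zero (x : Box L) : boxChar L 0 x = 1 := by
  simp [boxChar]

lemma norm_boxChar (k : Fin 3 → ℤ) (x : Box L) : ‖boxChar L k x‖ = 1 := by
  simp only [boxChar, fourier_apply, norm_prod, Circle.norm_coe, Finset.prod_const_one]

lemma continuous_boxChar (k : Fin 3 → ℤ) : Continuous (boxChar L k) := (boxCharC L k).continuous

lemma boxChar_single (z : Box L) (i : Fin 3) :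
    boxChar L (Pi.single i 1) z = fourier 1 (z i) := by
  rw [boxChar, Finset.prod_eq_single i]
  · simp
  · intro j _ hj
    rw [Pi.single_eq_of_ne hj, fourier_zero]
  · simp

/-- The star subalgebra generated by the characters. -/
noncomputable def boxSubalgebra (L : ℝ) : StarSubalgebra ℂ C(Box L, ℂ) where
  toSubalgebra := Algebra.adjoin ℂ (range (boxCharC L))
  star_mem' := by
    change Algebra.adjoin ℂ (range (boxCharC L)) ≤ star (Algebra.adjoin ℂ (range (boxCharC L)))
    refine Algebra.adjoin_le ?_
    rintro _ ⟨n, rfl⟩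
    refine Algebra.subset_adjoin ⟨-n, ?_⟩
    ext1 x
    simp only [boxCharC_apply, boxChar_neg, starRingEnd_apply, ContinuousMap.star_apply]

lemma boxSubalgebra_coe :
    (boxSubalgebra L).toSubalgebra.toSubmodule = Submodule.span ℂ (range (boxCharC L)) := by
  apply Algebra.adjoin_eq_span_of_subset
  refine .trans (fun x ↦ Submonoid.closure_induction (fun _ ↦ id) ⟨0, ?_⟩ ?_) Submodule.subset_span
  · ext z
    simp
  · rintro _ _ _ _ ⟨m, rfl⟩ ⟨n, rfl⟩
    refine ⟨m + n, ?_⟩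
    ext z
    simp [boxChar_add]

variable [hL : Fact (0 < L)]

/-- Points that differ in coordinate `i` are told apart by the character of frequency `Pi.single i
1`, because `AddCircle.toCircle` is injective. -/
lemma boxSubalgebra_separatesPoints : (boxSubalgebra L).SeparatesPoints := by
  classical
  intro x y hxy
  rw [Ne, funext_iff, not_forall] at hxy
  obtain ⟨i, hi⟩ := hxy
  refine ⟨_, ⟨boxCharC L (Pi.single i 1), Algebra.subset_adjoin ⟨Pi.single i 1, rfl⟩, rfl⟩, ?_⟩
  dsimp only
  rw [boxCharC_apply, boxCharC_apply, boxChar_single, boxChar_single, fourier_one, fourier_one]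
  contrapose hi
  exact AddCircle.injective_toCircle hL.out.ne' (Circle.ext hi)

/-- Stone-Weierstrass on the compact torus. -/
lemma span_boxCharC_closure_eq_top :
    (Submodule.span ℂ (range (boxCharC L))).topologicalClosure = ⊤ := by
  rw [← boxSubalgebra_coe]
  exact congr_arg (Subalgebra.toSubmodule <| StarSubalgebra.toSubalgebra ·)
    (ContinuousMap.starSubalgebra_topologicalClosure_eq_top_of_separatesPoints _
      boxSubalgebra_separatesPoints)

lemma volume_box_univ : (volume : Measure (Box L)).real univ = L ^ 3 := by
  have : (volume : Measure (Box L)) univ = ENNReal.ofReal (L ^ 3) := by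
    rw [volume_pi, Measure.pi_univ]
    simp [AddCircle.measure_univ, ENNReal.ofReal_pow hL.out.le]
  rw [Measure.real, this, ENNReal.toReal_ofReal (by have := hL.out; positivity)]

lemma integral_fourier_eq_zero {n : ℤ} (hn : n ≠ 0) : ∫ x : AddCircle L, fourier n x = 0 := by
  have h := (orthonormal_iff_ite.mp <| orthonormal_fourier (T := L)) 0 n
  rw [if_neg hn.symm, ContinuousMap.inner_toLp] at h
  rw [AddCircle.volume_eq_smul_haarAddCircle, integral_smul_measure]
  simp only [← fourier_neg, ← fourier_add] at h
  simp only [neg_zero, add_zero] at h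
  rw [h, smul_zero]

lemma integral_boxChar (k : Fin 3 → ℤ) :
    ∫ x : Box L, boxChar L k x = if k = 0 then ((L ^ 3 : ℝ) : ℂ) else 0 := by
  split_ifs with h
  · subst h
    simp [volume_box_univ]
  · unfold boxChar
    rw [MeasureTheory.integral_fintype_prod_volume_eq_prod]
    obtain ⟨i, hi⟩ := Function.ne_iff.mp h
    exact Finset.prod_eq_zero (Finset.mem_univ i) (integral_fourier_eq_zero hi)

/-- The normalised characters in `L²`. -/
noncomputable def boxOrtho (L : ℝ) [Fact (0 < L)] (k : Fin 3 → ℤ) :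
    Lp ℂ 2 (volume : Measure (Box L)) :=
  (((Real.sqrt (L ^ 3))⁻¹ : ℝ) : ℂ) • ContinuousMap.toLp (E := ℂ) 2 volume ℂ (boxCharC L k)

lemma sqrt_side_pos : 0 < Real.sqrt (L ^ 3) := by
  have := hL.out
  positivity

lemma orthonormal_boxOrtho : Orthonormal ℂ (boxOrtho L) := by
  rw [orthonormal_iff_ite]
  intro m n
  have hs := sqrt_side_pos (L := L)
  have hs2 : Real.sqrt (L ^ 3) * Real.sqrt (L ^ 3) = L ^ 3 :=
    Real.mul_self_sqrt (by have := hL.out; positivity)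
  simp only [boxOrtho, inner_smul_left, inner_smul_right, ContinuousMap.inner_toLp,
    boxCharC_apply, ← boxChar_neg, ← boxChar_add, integral_boxChar, Complex.conj_ofReal]
  have : (n + -m = 0) ↔ m = n := by rw [← sub_eq_add_neg, sub_eq_zero, eq_comm]
  simp only [this]
  split_ifs with h
  · generalize Real.sqrt (L ^ 3) = s at *
    rw [← hs2]
    norm_cast
    field_simp
  · simp

/-- Uniform density passes to `L²` because continuous functions are dense there; the normalising
factor is nonzero and does not change the span. -/
lemma span_boxOrtho_closure_eq_top :
    (Submodule.span ℂ (range (boxOrtho L))).topologicalClosure = ⊤ := by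
  have h : (Submodule.span ℂ (range fun k : Fin 3 → ℤ =>
      ContinuousMap.toLp (E := ℂ) 2 (volume : Measure (Box L)) ℂ
        (boxCharC L k))).topologicalClosure = ⊤ := by
    simpa only [Submodule.map_span, ContinuousLinearMap.coe_coe, ← range_comp, Function.comp_def]
      using (ContinuousMap.toLp_denseRange ℂ (volume : Measure (Box L)) ℂ
        (by simp : (2 : ℝ≥0∞) ≠ ⊤)).topologicalClosure_map_submodule span_boxCharC_closure_eq_top
  rw [← h]
  congr 1
  have hs : (((Real.sqrt (L ^ 3))⁻¹ : ℝ) : ℂ) ≠ 0 := by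
    exact_mod_cast (inv_pos.2 sqrt_side_pos).ne'
  refine le_antisymm (Submodule.span_le.2 ?_) (Submodule.span_le.2 ?_)
  · rintro _ ⟨k, rfl⟩
    exact Submodule.smul_mem _ _ (Submodule.subset_span ⟨k, rfl⟩)
  · rintro _ ⟨k, rfl⟩
    have : ContinuousMap.toLp (E := ℂ) 2 (volume : Measure (Box L)) ℂ (boxCharC L k) =
        (((Real.sqrt (L ^ 3))⁻¹ : ℝ) : ℂ)⁻¹ • boxOrtho L k := by
      rw [boxOrtho, inv_smul_smul₀ hs]
    simp only [this]
    exact Submodule.smul_mem _ _ (Submodule.subset_span ⟨k, rfl⟩)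

/-- The Hilbert basis of normalised characters. -/
noncomputable def boxBasis (L : ℝ) [Fact (0 < L)] :
    HilbertBasis (Fin 3 → ℤ) ℂ (Lp ℂ 2 (volume : Measure (Box L))) :=
  HilbertBasis.mk orthonormal_boxOrtho span_boxOrtho_closure_eq_top.ge

lemma boxBasis_repr (g : Lp ℂ 2 (volume : Measure (Box L))) (k : Fin 3 → ℤ) :
    (boxBasis L).repr g k =
      (((Real.sqrt (L ^ 3))⁻¹ : ℝ) : ℂ) * ∫ x : Box L, boxChar L (-k) x * g x := by
  rw [HilbertBasis.repr_apply_apply, boxBasis, HilbertBasis.coe_mk, boxOrtho, inner_smul_left,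
    Complex.conj_ofReal, MeasureTheory.L2.inner_def]
  congr 1
  apply integral_congr_ae
  filter_upwards [ContinuousMap.coeFn_toLp (𝕜 := ℂ) (p := 2)
    (volume : Measure (Box L)) (boxCharC L k)] with x hx
  rw [hx, boxChar_neg, RCLike.inner_apply, mul_comm, boxCharC_apply]

end Characters

/-! ### Fourier coefficients of real vector fields: Parseval, uniqueness, Riesz-Fischer. -/

section Coefficients

open scoped ComplexConjugate

variable {L : ℝ} [hL : Fact (0 < L)]

/-- The `j`-th coordinate as a continuous linear form. -/
noncomputable abbrev coordCLM (j : Fin 3) : EuclideanSpace ℝ (Fin 3) →L[ℝ] ℝ :=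
  EuclideanSpace.proj j

/-- The `j`-th component of a field as a complex-valued square-integrable function. -/
noncomputable def fieldComp (v : Field2 L) (j : Fin 3) : Lp ℂ 2 (volume : Measure (Box L)) :=
  (Complex.ofRealCLM.comp (coordCLM j)).compLp v

lemma coeFn_fieldComp (v : Field2 L) (j : Fin 3) :
    fieldComp v j =ᵐ[volume] fun x => ((v x j : ℝ) : ℂ) := by
  filter_upwards [ContinuousLinearMap.coeFn_compLp
    (Complex.ofRealCLM.comp (coordCLM j)) v] with x hx
  rw [fieldComp, hx]
  rfl

/-- The factor `1 / L ^ 3` in `fcoef` is split into two roots, one of which is the normalisation of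
the basis. -/
lemma fcoef_eq_repr (v : Field2 L) (k : Fin 3 → ℤ) (j : Fin 3) :
    fcoef L v k j =
      (((Real.sqrt (L ^ 3))⁻¹ : ℝ) : ℂ) * (boxBasis L).repr (fieldComp v j) k := by
  have hs2 : Real.sqrt (L ^ 3) * Real.sqrt (L ^ 3) = L ^ 3 :=
    Real.mul_self_sqrt (by have := hL.out; positivity)
  rw [boxBasis_repr, fcoef, ← mul_assoc, ← Complex.ofReal_mul, ← mul_inv, hs2, one_div]
  congr 1
  apply integral_congr_ae
  filter_upwards [coeFn_fieldComp v j] with x hx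
  rw [hx]

lemma integral_ofReal_eq (v : Field2 L) (j : Fin 3) :
    ∫ x : Box L, ((v x j : ℝ) : ℂ) = (((∫ x : Box L, v x) j : ℝ) : ℂ) := by
  have hv : Integrable v (volume : Measure (Box L)) :=
    (Lp.memLp v).integrable (by norm_num)
  exact (Complex.ofRealCLM.comp (coordCLM j)).integral_comp_comm hv

lemma fcoef_zero_eq (v : Field2 L) (j : Fin 3) :
    fcoef L v 0 j = ((1 / L ^ 3 : ℝ) : ℂ) * (((∫ x : Box L, v x) j : ℝ) : ℂ) := by
  rw [← integral_ofReal_eq, fcoef]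
  simp

lemma integral_eq_zero_iff_fcoef (v : Field2 L) :
    ∫ x : Box L, v x = 0 ↔ ∀ j, fcoef L v 0 j = 0 := by
  have h3 : ((1 / L ^ 3 : ℝ) : ℂ) ≠ 0 := by
    have := hL.out
    exact_mod_cast (by positivity : (1 / L ^ 3 : ℝ) ≠ 0)
  simp only [fcoef_zero_eq, mul_eq_zero, h3, false_or, Complex.ofReal_eq_zero]
  constructor
  · intro h j
    rw [h]
    rfl
  · intro h
    ext j
    exact h j

lemma fcoef_neg (v : Field2 L) (k : Fin 3 → ℤ) (j : Fin 3) :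
    fcoef L v (-k) j = conj (fcoef L v k j) := by
  rw [fcoef, fcoef, map_mul, Complex.conj_ofReal, ← integral_conj]
  congr 2
  ext x
  rw [map_mul, Complex.conj_ofReal, boxChar_neg]

/-- Parseval's identity. -/
lemma hasSum_inner_fcoef (v w : Field2 L) :
    HasSum (fun k => L ^ 3 * ∑ j, (fcoef L v k j * conj (fcoef L w k j)).re) (inner ℝ v w) := by
  have hs := sqrt_side_pos (L := L)
  have hs2 : Real.sqrt (L ^ 3) * Real.sqrt (L ^ 3) = L ^ 3 :=
    Real.mul_self_sqrt (by have := hL.out; positivity)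
  have key : ∀ j, HasSum (fun k => L ^ 3 * (fcoef L v k j * conj (fcoef L w k j)).re)
      (∫ x : Box L, v x j * w x j) := by
    intro j
    -- The complex inner product is conjugate-linear in its first slot, so `w` goes first to end up
    -- with the conjugate.
    have h := (boxBasis L).hasSum_inner_mul_inner (fieldComp w j) (fieldComp v j)
    have h' := Complex.hasSum_re h
    convert h' using 1
    · ext k
      rw [fcoef_eq_repr, fcoef_eq_repr, HilbertBasis.repr_apply_apply,
        HilbertBasis.repr_apply_apply]
      generalize Real.sqrt (L ^ 3) = s at *
      rw [← hs2, map_mul, Complex.conj_ofReal, inner_conj_symm]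
      generalize inner ℂ ((boxBasis L) k) (fieldComp v j) = a
      generalize inner ℂ (fieldComp w j) ((boxBasis L) k) = b
      have : ((s⁻¹ : ℝ) : ℂ) * a * (((s⁻¹ : ℝ) : ℂ) * b) = ((s⁻¹ * s⁻¹ : ℝ) : ℂ) * (b * a) := by
        push_cast
        ring
      rw [this, Complex.re_ofReal_mul]
      field_simp
    · rw [MeasureTheory.L2.inner_def]
      have : ∫ x : Box L, inner ℂ (fieldComp w j x) (fieldComp v j x) =
          ∫ x : Box L, ((v x j * w x j : ℝ) : ℂ) := by
        apply integral_congr_ae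
        filter_upwards [coeFn_fieldComp v j, coeFn_fieldComp w j] with x hx hy
        rw [hx, hy, RCLike.inner_apply, Complex.conj_ofReal]
        push_cast
        rfl
      rw [this, integral_complex_ofReal, Complex.ofReal_re]
  have hsum := hasSum_sum (s := Finset.univ) (fun j _ => key j)
  convert hsum using 1
  · ext k
    rw [Finset.mul_sum]
  · rw [MeasureTheory.L2.inner_def, ← integral_finsetSum]
    · apply integral_congr_ae
      filter_upwards with x
      rw [PiLp.inner_apply]
      simp only [RCLike.inner_apply, conj_trivial]
      exact Finset.sum_congr rfl fun j _ => mul_comm _ _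
    · intro j _
      have h1 : ∀ v : Field2 L, MemLp (fun x => v x j) 2 (volume : Measure (Box L)) := fun v =>
        (coordCLM j).comp_memLp' (Lp.memLp v)
      exact (h1 v).integrable_mul (h1 w)

lemma hasSum_norm_sq_fcoef (v : Field2 L) :
    HasSum (fun k => L ^ 3 * ∑ j, ‖fcoef L v k j‖ ^ 2) (‖v‖ ^ 2) := by
  have := hasSum_inner_fcoef v v
  rw [real_inner_self_eq_norm_sq] at this
  convert this using 4 with k j
  rw [Complex.mul_conj, Complex.ofReal_re, Complex.normSq_eq_norm_sq]

lemma summable_norm_sq_fcoef (v : Field2 L) :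
    Summable (fun k => ∑ j, ‖fcoef L v k j‖ ^ 2) := by
  have h3 : L ^ 3 ≠ 0 := by have := hL.out; positivity
  exact (summable_mul_left_iff h3).1 (hasSum_norm_sq_fcoef v).summable

lemma field_ext_fcoef {v w : Field2 L} (h : ∀ k j, fcoef L v k j = fcoef L w k j) : v = w := by
  have h1 := hasSum_inner_fcoef v v
  have h2 := hasSum_inner_fcoef v w
  have h3 := hasSum_inner_fcoef w w
  simp only [h] at h1 h2
  have e1 := h1.unique h3
  have e2 := h2.unique h3
  rw [← sub_eq_zero, ← norm_eq_zero, ← sq_eq_zero_iff, ← real_inner_self_eq_norm_sq,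
    inner_sub_left, inner_sub_right, inner_sub_right, real_inner_comm v w, e1, e2]
  ring

/-- Riesz-Fischer gives complex components `g j`; their real parts form the field. Hermitian
symmetry of `c` says that `g j` and its conjugate have the same coefficients, so passing to the real
part changes none of them. -/
lemma exists_field_of_coef (c : (Fin 3 → ℤ) → Fin 3 → ℂ)
    (hc : ∀ k j, c (-k) j = conj (c k j)) (hs : Summable fun k => ∑ j, ‖c k j‖ ^ 2) :
    ∃ v : Field2 L, ∀ k j, fcoef L v k j = c k j := by
  have hs0 := sqrt_side_pos (L := L)
  have hs2 : Real.sqrt (L ^ 3) * Real.sqrt (L ^ 3) = L ^ 3 :=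
    Real.mul_self_sqrt (by have := hL.out; positivity)
  have hm : ∀ j, Memℓp (fun k => ((Real.sqrt (L ^ 3) : ℝ) : ℂ) * c k j) 2 := by
    intro j
    rw [memℓp_gen_iff (by norm_num)]
    have : Summable fun k => ‖c k j‖ ^ 2 :=
      Summable.of_nonneg_of_le (fun _ => by positivity)
        (fun k => Finset.single_le_sum (f := fun j => ‖c k j‖ ^ 2)
          (fun _ _ => by positivity) (Finset.mem_univ j)) hs
    refine (this.mul_left (Real.sqrt (L ^ 3) ^ 2)).congr fun k => ?_
    simp [mul_pow, abs_of_pos hs0]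
  let g : Fin 3 → Lp ℂ 2 (volume : Measure (Box L)) := fun j =>
    (boxBasis L).repr.symm ⟨_, hm j⟩
  have hg : ∀ k j, (((Real.sqrt (L ^ 3))⁻¹ : ℝ) : ℂ) * ∫ x : Box L, boxChar L (-k) x * g j x =
      ((Real.sqrt (L ^ 3) : ℝ) : ℂ) * c k j := by
    intro k j
    rw [← boxBasis_repr, LinearIsometryEquiv.apply_symm_apply]
  have hg' : ∀ k j, ((1 / L ^ 3 : ℝ) : ℂ) * ∫ x : Box L, boxChar L (-k) x * g j x = c k j := by
    intro k j
    have hne : ((Real.sqrt (L ^ 3) : ℝ) : ℂ) ≠ 0 := by exact_mod_cast hs0.ne'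
    have := hg k j
    have h1 : (1 / L ^ 3 : ℝ) = (Real.sqrt (L ^ 3))⁻¹ * (Real.sqrt (L ^ 3))⁻¹ := by
      rw [← mul_inv, hs2, one_div]
    rw [h1, Complex.ofReal_mul, mul_assoc, this, Complex.ofReal_inv,
      inv_mul_cancel_left₀ hne]
  have hmem : MemLp (fun x : Box L => WithLp.toLp 2 (fun j => (g j x).re)) 2
      (volume : Measure (Box L)) := by
    have : MemLp (fun x : Box L => (fun j => (g j x).re)) 2 (volume : Measure (Box L)) :=
      memLp_pi_iff.2 fun j => (Lp.memLp (g j)).re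
    exact (PiLp.continuousLinearEquiv 2 ℝ
      (fun _ : Fin 3 => ℝ)).symm.toContinuousLinearMap.comp_memLp' this
  refine ⟨hmem.toLp _, fun k j => ?_⟩
  have hint : ∀ k j, Integrable (fun x : Box L => boxChar L k x * g j x) := by
    intro k j
    refine ((Lp.memLp (g j)).integrable (by norm_num)).bdd_mul (c := 1)
      (continuous_boxChar k).aestronglyMeasurable ?_
    filter_upwards with x
    rw [norm_boxChar]
  have h1 : ∫ x : Box L, boxChar L (-k) x * (((hmem.toLp _ : Field2 L) x j : ℝ) : ℂ) =
      (1 / 2 : ℂ) * ((∫ x : Box L, boxChar L (-k) x * g j x) +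
        conj (∫ x : Box L, boxChar L k x * g j x)) := by
    rw [← integral_conj, ← integral_add (hint _ _), ← integral_const_mul]
    · apply integral_congr_ae
      filter_upwards [hmem.coeFn_toLp] with x hx
      rw [hx]
      simp only [map_mul, boxChar_neg]
      have := Complex.re_eq_add_conj (g j x)
      simp only [this]
      ring
    · exact (Complex.conjCLE.integrable_comp_iff).2 (hint k j)
  have h2 := hg' k j
  have h3 := congrArg conj (hg' (-k) j)
  rw [neg_neg, map_mul, Complex.conj_ofReal, hc, Complex.conj_conj] at h3
  rw [fcoef, h1, mul_left_comm, mul_add, h2, h3]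
  ring

/-- A field with absolutely summable Fourier coefficients is bounded by their sum. -/
lemma ae_abs_le_tsum_norm_fcoef (v : Field2 L) (j : Fin 3)
    (hs : Summable fun k => ‖fcoef L v k j‖) :
    ∀ᵐ x : Box L, |v x j| ≤ ∑' k, ‖fcoef L v k j‖ := by
  have hs0 := sqrt_side_pos (L := L)
  have hnorm : ∀ k, ‖fcoef L v k j • boxCharC L k‖ ≤ ‖fcoef L v k j‖ := by
    intro k
    refine (ContinuousMap.norm_le _ (norm_nonneg _)).2 fun x => ?_
    simp [norm_boxChar]
  have hsum : Summable fun k => fcoef L v k j • boxCharC L k :=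
    Summable.of_norm_bounded (E := C(Box L, ℂ)) hs hnorm
  have h1 := (ContinuousMap.toLp (E := ℂ) 2 (volume : Measure (Box L)) ℂ).hasSum hsum.hasSum
  have h2 := (boxBasis L).hasSum_repr (fieldComp v j)
  -- The Fourier series converges uniformly by absolute summability and in `L²` by the Hilbert
  -- basis; the two limits coincide.
  have h3 : fieldComp v j = ContinuousMap.toLp (E := ℂ) 2 (volume : Measure (Box L)) ℂ
      (∑' k, fcoef L v k j • boxCharC L k) := by
    refine h2.unique (h1.congr_fun fun k => ?_)
    rw [map_smul, boxBasis, HilbertBasis.coe_mk, boxOrtho, smul_smul, mul_comm, ← boxBasis,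
      ← fcoef_eq_repr]
  filter_upwards [coeFn_fieldComp v j, ContinuousMap.coeFn_toLp (𝕜 := ℂ) (p := 2)
    (volume : Measure (Box L)) (∑' k, fcoef L v k j • boxCharC L k)] with x hx hy
  rw [← h3, hx] at hy
  calc |v x j| = ‖((v x j : ℝ) : ℂ)‖ := by rw [Complex.norm_real, Real.norm_eq_abs]
    _ ≤ ‖∑' k, fcoef L v k j • boxCharC L k‖ := by rw [hy]; exact ContinuousMap.norm_coe_le_norm _ _
    _ ≤ ∑' k, ‖fcoef L v k j • boxCharC L k‖ :=
      norm_tsum_le_tsum_norm (.of_nonneg_of_le (fun _ => norm_nonneg _) hnorm hs)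
    _ ≤ ∑' k, ‖fcoef L v k j‖ := by
      exact Summable.tsum_le_tsum hnorm (.of_nonneg_of_le (fun _ => norm_nonneg _) hnorm hs) hs

end Coefficients

/-! ### A lattice sum over nonzero frequencies. -/

section LatticeSum

/-- The squared Euclidean length of a frequency. -/
def freqSq (k : Fin 3 → ℤ) : ℝ := ∑ i, (k i : ℝ) ^ 2

lemma freqSq_nonneg (k : Fin 3 → ℤ) : 0 ≤ freqSq k := Finset.sum_nonneg fun _ _ => sq_nonneg _

lemma freqSq_zero : freqSq 0 = 0 := by simp [freqSq]

lemma sq_le_freqSq (k : Fin 3 → ℤ) (i : Fin 3) : (k i : ℝ) ^ 2 ≤ freqSq k :=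
  Finset.single_le_sum (f := fun i => (k i : ℝ) ^ 2) (fun _ _ => sq_nonneg _) (Finset.mem_univ i)

lemma one_le_freqSq {k : Fin 3 → ℤ} (hk : k ≠ 0) : 1 ≤ freqSq k := by
  obtain ⟨i, hi⟩ := Function.ne_iff.mp hk
  have h1 : (1 : ℝ) ≤ (k i : ℝ) ^ 2 := by
    have : (1 : ℤ) ≤ (k i) ^ 2 := by
      have := sq_pos_of_ne_zero (a := k i) hi
      omega
    exact_mod_cast this
  exact h1.trans (sq_le_freqSq k i)

/-- The sup-norm of a frequency. -/
def freqSup (k : Fin 3 → ℤ) : ℕ := Finset.univ.sup fun i => (k i).natAbs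

lemma freqSup_sq_le (k : Fin 3 → ℤ) : (freqSup k : ℝ) ^ 2 ≤ freqSq k := by
  obtain ⟨i, -, hi⟩ := Finset.exists_mem_eq_sup Finset.univ Finset.univ_nonempty
    fun i => (k i).natAbs
  rw [freqSup, hi]
  have : (((k i).natAbs : ℕ) : ℝ) ^ 2 = (k i : ℝ) ^ 2 := by
    rw [Nat.cast_natAbs, Int.cast_abs, sq_abs]
  rw [this]
  exact sq_le_freqSq k i

/-- A sup-norm shell lies between two concentric cubes, and `(2m+3)³ - (2m+1)³ = 24m² + 48m + 26`.
-/
lemma card_shell_le (s : Finset (Fin 3 → ℤ)) (m : ℕ) :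
    ((s.filter fun k => freqSup k = m + 1).card : ℝ) ≤ 26 * ((m : ℝ) + 1) ^ 2 := by
  classical
  let A : Finset (Fin 3 → ℤ) := Fintype.piFinset fun _ => Finset.Icc (-((m : ℤ) + 1)) (m + 1)
  let B : Finset (Fin 3 → ℤ) := Fintype.piFinset fun _ => Finset.Icc (-(m : ℤ)) m
  have hBA : B ⊆ A := by
    refine Fintype.piFinset_subset _ _ fun _ => Finset.Icc_subset_Icc ?_ ?_ <;> omega
  have hsub : (s.filter fun k => freqSup k = m + 1) ⊆ A \ B := by
    intro k hk
    have hk' : freqSup k = m + 1 := (Finset.mem_filter.1 hk).2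
    rw [Finset.mem_sdiff]
    constructor
    · rw [Fintype.mem_piFinset]
      intro i
      have : (k i).natAbs ≤ m + 1 := hk' ▸ Finset.le_sup (f := fun i => (k i).natAbs)
        (Finset.mem_univ i)
      rw [Finset.mem_Icc]
      omega
    · intro hB
      rw [Fintype.mem_piFinset] at hB
      have : freqSup k ≤ m := Finset.sup_le fun i _ => by
        have := Finset.mem_Icc.1 (hB i)
        omega
      omega
  have hA : A.card = (2 * m + 3) ^ 3 := by
    rw [Fintype.card_piFinset_const, Int.card_Icc]
    congr 1
    omega
  have hB : B.card = (2 * m + 1) ^ 3 := by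
    rw [Fintype.card_piFinset_const, Int.card_Icc]
    congr 1
    omega
  have h1 := Finset.card_le_card hsub
  have h2 := Finset.card_sdiff_add_card_eq_card hBA
  have h3 : (s.filter fun k => freqSup k = m + 1).card + (2 * m + 1) ^ 3 ≤ (2 * m + 3) ^ 3 := by
    rw [← hA, ← hB]
    omega
  have h4 : ((s.filter fun k => freqSup k = m + 1).card : ℝ) + (2 * m + 1) ^ 3 ≤
      (2 * m + 3) ^ 3 := by exact_mod_cast h3
  nlinarith [(Nat.cast_nonneg m : (0 : ℝ) ≤ m)]

/-- Since `(m+1)² + r² ≥ (m+1+r)²/2`, each term is at most `2 / ((m+r)(m+1+r))`, which telescopes.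
-/
lemma sum_inv_sq_add_sq_le {r : ℝ} (hr : 0 < r) (N : ℕ) :
    ∑ m ∈ Finset.range N, 1 / (((m : ℝ) + 1) ^ 2 + r ^ 2) ≤ 2 / r := by
  have h1 : ∀ m ∈ Finset.range N, 1 / (((m : ℝ) + 1) ^ 2 + r ^ 2) ≤
      2 / ((m : ℝ) + r) - 2 / (((m + 1 : ℕ) : ℝ) + r) := by
    intro m _
    have hm : (0 : ℝ) ≤ m := Nat.cast_nonneg m
    push_cast
    rw [div_sub_div _ _ (by positivity) (by positivity), div_le_div_iff₀ (by positivity)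
      (by positivity)]
    nlinarith [sq_nonneg ((m : ℝ) + 1 - r)]
  refine (Finset.sum_le_sum h1).trans ?_
  rw [Finset.sum_range_sub' fun m : ℕ => 2 / ((m : ℝ) + r)]
  have : 0 ≤ 2 / ((N : ℝ) + r) := by positivity
  simp only [Nat.cast_zero, zero_add]
  linarith

/-- Summation by sup-norm shells: `26 (m+1)²` points, each contributing at most `1 / ((m+1)² ((m+1)²
+ r²))`. The constant is `26 * 2`. -/
lemma sum_lattice_le {r : ℝ} (hr : 0 < r) (s : Finset (Fin 3 → ℤ)) :
    ∑ k ∈ s, 1 / (freqSq k * (freqSq k + r ^ 2)) ≤ 52 / r := by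
  classical
  let F : (Fin 3 → ℤ) → ℝ := fun k => 1 / (freqSq k * (freqSq k + r ^ 2))
  let N := s.sup freqSup
  have hmaps : ∀ k ∈ s, freqSup k ∈ Finset.range (N + 1) := fun k hk =>
    Finset.mem_range.2 (Nat.lt_succ_of_le (Finset.le_sup hk))
  change ∑ k ∈ s, F k ≤ _
  rw [← Finset.sum_fiberwise_of_maps_to hmaps F, Finset.sum_range_succ']
  -- Only the zero frequency lies in this shell, and its term is `1 / 0 = 0`.
  have h0 : ∑ k ∈ s with freqSup k = 0, F k = 0 := by
    refine Finset.sum_eq_zero fun k hk => ?_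
    have hk0 : freqSup k = 0 := (Finset.mem_filter.1 hk).2
    have : k = 0 := by
      ext i
      have : (k i).natAbs ≤ 0 := hk0 ▸ Finset.le_sup (f := fun i => (k i).natAbs)
        (Finset.mem_univ i)
      simpa using this
    simp [F, this, freqSq_zero]
  rw [h0, add_zero]
  have hm : ∀ m ∈ Finset.range N, ∑ k ∈ s with freqSup k = m + 1, F k ≤
      26 * (1 / (((m : ℝ) + 1) ^ 2 + r ^ 2)) := by
    intro m _
    have hb : ∀ k ∈ s.filter fun k => freqSup k = m + 1, F k ≤
        1 / (((m : ℝ) + 1) ^ 2 * (((m : ℝ) + 1) ^ 2 + r ^ 2)) := by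
      intro k hk
      have hk' : freqSup k = m + 1 := (Finset.mem_filter.1 hk).2
      have := freqSup_sq_le k
      rw [hk'] at this
      push_cast at this
      have := freqSq_nonneg k
      exact one_div_le_one_div_of_le (by positivity) (by gcongr)
    refine (Finset.sum_le_card_nsmul _ _ _ hb).trans ?_
    rw [nsmul_eq_mul]
    refine (mul_le_mul_of_nonneg_right (card_shell_le s m) (by positivity)).trans_eq ?_
    field_simp
  refine (Finset.sum_le_sum hm).trans ?_
  rw [← Finset.mul_sum]
  refine (mul_le_mul_of_nonneg_left (sum_inv_sq_add_sq_le hr N) (by norm_num)).trans_eq ?_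
  ring

end LatticeSum

/-! ### Powers of the Stokes operator, Poincaré and Agmon inequalities. -/

section StokesNorms

open scoped ComplexConjugate

variable {L : ℝ}

lemma stokesEig_eq (k : Fin 3 → ℤ) : stokesEig L k = (2 * Real.pi / L) ^ 2 * freqSq k := rfl

lemma stokesEig_nonneg (k : Fin 3 → ℤ) : 0 ≤ stokesEig L k :=
  mul_nonneg (sq_nonneg _) (freqSq_nonneg k)

lemma stokesEig_ge {k : Fin 3 → ℤ} (hk : k ≠ 0) : (2 * Real.pi / L) ^ 2 ≤ stokesEig L k := by
  rw [stokesEig_eq]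
  exact le_mul_of_one_le_right (sq_nonneg _) (one_le_freqSq hk)

lemma stokesEig_zero : stokesEig L 0 = 0 := by rw [stokesEig_eq, freqSq_zero, mul_zero]

variable [hL : Fact (0 < L)]

/-- The squared length of the vector Fourier coefficient at `k`. -/
noncomputable def coefSq (v : Field2 L) (k : Fin 3 → ℤ) : ℝ := ∑ j, ‖fcoef L v k j‖ ^ 2

lemma coefSq_nonneg (v : Field2 L) (k : Fin 3 → ℤ) : 0 ≤ coefSq v k :=
  Finset.sum_nonneg fun _ _ => sq_nonneg _

lemma norm_sq_fcoef_le_coefSq (v : Field2 L) (k : Fin 3 → ℤ) (j : Fin 3) :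
    ‖fcoef L v k j‖ ^ 2 ≤ coefSq v k :=
  Finset.single_le_sum (f := fun j => ‖fcoef L v k j‖ ^ 2) (fun _ _ => sq_nonneg _)
    (Finset.mem_univ j)

lemma wavenumber_pos : 0 < 2 * Real.pi / L := by
  have := hL.out
  positivity

lemma stokesEig_pos {k : Fin 3 → ℤ} (hk : k ≠ 0) : 0 < stokesEig L k :=
  (pow_pos wavenumber_pos 2).trans_le (stokesEig_ge hk)

lemma side_cube_pos : 0 < L ^ 3 := pow_pos hL.out 3

lemma stokesInner_self (s : ℝ) (v : Field2 L) :
    stokesInner L s v v = L ^ 3 * ∑' k, stokesEig L k ^ (2 * s) * coefSq v k := by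
  rw [stokesInner]
  congr 2
  ext k
  congr 1
  refine Finset.sum_congr rfl fun j _ => ?_
  rw [Complex.mul_conj, Complex.ofReal_re, Complex.normSq_eq_norm_sq]

lemma stokesNorm_sq (s : ℝ) (v : Field2 L) :
    stokesNorm L s v ^ 2 = L ^ 3 * ∑' k, stokesEig L k ^ (2 * s) * coefSq v k := by
  have h : 0 ≤ L ^ 3 * ∑' k, stokesEig L k ^ (2 * s) * coefSq v k :=
    mul_nonneg side_cube_pos.le (tsum_nonneg fun k =>
      mul_nonneg (Real.rpow_nonneg (stokesEig_nonneg k) _) (coefSq_nonneg v k))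
  rw [stokesNorm, stokesInner_self, Real.sq_sqrt h]

lemma stokesNorm_nonneg (s : ℝ) (v : Field2 L) : 0 ≤ stokesNorm L s v := Real.sqrt_nonneg _

lemma fcoef_zero_of_mem_spaceH {v : Field2 L} (hv : v ∈ spaceH L) (j : Fin 3) :
    fcoef L v 0 j = 0 := (integral_eq_zero_iff_fcoef v).1 hv.2 j

lemma coefSq_zero_of_mem_spaceH {v : Field2 L} (hv : v ∈ spaceH L) : coefSq v 0 = 0 := by
  simp [coefSq, fcoef_zero_of_mem_spaceH hv]

lemma summable_coefSq (v : Field2 L) : Summable (coefSq v) := summable_norm_sq_fcoef v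

lemma norm_sq_eq_tsum_coefSq (v : Field2 L) : ‖v‖ ^ 2 = L ^ 3 * ∑' k, coefSq v k := by
  rw [← (hasSum_norm_sq_fcoef v).tsum_eq, tsum_mul_left]
  rfl

/-- The domains of the powers of the Stokes operator decrease with the exponent. -/
lemma stokesDomain_mono {s t : ℝ} (h : s ≤ t) {v : Field2 L} (hv : v ∈ stokesDomain L t) :
    v ∈ stokesDomain L s := by
  refine ⟨hv.1, ?_⟩
  have h2 := hv.2.mul_left (((2 * Real.pi / L) ^ 2) ^ (2 * (s - t)))
  refine Summable.of_nonneg_of_le (fun k => mul_nonneg (Real.rpow_nonneg (stokesEig_nonneg k) _)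
    (coefSq_nonneg v k)) (fun k => ?_) h2
  by_cases hk : k = 0
  · subst hk
    have := coefSq_zero_of_mem_spaceH hv.1
    rw [coefSq] at this
    rw [this]
    simp
  · have hp := stokesEig_pos (L := L) hk
    have e : stokesEig L k ^ (2 * s) = stokesEig L k ^ (2 * (s - t)) * stokesEig L k ^ (2 * t) := by
      rw [← Real.rpow_add hp]
      congr 1
      ring
    rw [e, mul_assoc]
    refine mul_le_mul_of_nonneg_right ?_ (mul_nonneg (Real.rpow_nonneg hp.le _) (coefSq_nonneg v k))
    exact Real.rpow_le_rpow_of_nonpos (pow_pos wavenumber_pos 2) (stokesEig_ge hk) (by linarith)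

lemma summable_stokesEig_mul_coefSq {v : Field2 L} (hv : v ∈ spaceV L) :
    Summable fun k => stokesEig L k * coefSq v k := by
  refine hv.2.congr fun k => ?_
  norm_num
  exact Or.inl rfl

lemma stokesNorm_half_sq (v : Field2 L) :
    stokesNorm L (1 / 2) v ^ 2 = L ^ 3 * ∑' k, stokesEig L k * coefSq v k := by
  rw [stokesNorm_sq]
  norm_num

lemma summable_stokesEig_sq_mul_coefSq {v : Field2 L} (hv : v ∈ stokesDomain L 1) :
    Summable fun k => stokesEig L k ^ 2 * coefSq v k := by
  refine hv.2.congr fun k => ?_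
  norm_num
  exact Or.inl rfl

lemma stokesNorm_one_sq (v : Field2 L) :
    stokesNorm L 1 v ^ 2 = L ^ 3 * ∑' k, stokesEig L k ^ 2 * coefSq v k := by
  rw [stokesNorm_sq]
  norm_num

/-- Poincaré's inequality. -/
lemma poincare {v : Field2 L} (hv : v ∈ spaceV L) :
    (2 * Real.pi / L) ^ 2 * ‖v‖ ^ 2 ≤ stokesNorm L (1 / 2) v ^ 2 := by
  rw [stokesNorm_half_sq, norm_sq_eq_tsum_coefSq, mul_left_comm]
  refine mul_le_mul_of_nonneg_left ?_ side_cube_pos.le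
  rw [← tsum_mul_left]
  refine Summable.tsum_le_tsum (fun k => ?_) ((summable_coefSq v).mul_left _)
    (summable_stokesEig_mul_coefSq hv)
  by_cases hk : k = 0
  · rw [hk, coefSq_zero_of_mem_spaceH hv.1, mul_zero, mul_zero]
  · exact mul_le_mul_of_nonneg_right (stokesEig_ge hk) (coefSq_nonneg v k)

/-- Poincaré one half-power higher; it makes `‖A w‖` positive as soon as `‖A^(1/2) w‖` is. -/
lemma stokesNorm_half_le_one {v : Field2 L} (hv : v ∈ stokesDomain L 1) :
    (2 * Real.pi / L) ^ 2 * stokesNorm L (1 / 2) v ^ 2 ≤ stokesNorm L 1 v ^ 2 := by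
  rw [stokesNorm_half_sq, stokesNorm_one_sq, mul_left_comm]
  refine mul_le_mul_of_nonneg_left ?_ side_cube_pos.le
  rw [← tsum_mul_left]
  refine Summable.tsum_le_tsum (fun k => ?_)
    ((summable_stokesEig_mul_coefSq (stokesDomain_mono (by norm_num) hv)).mul_left _)
    (summable_stokesEig_sq_mul_coefSq hv)
  by_cases hk : k = 0
  · simp [hk, coefSq_zero_of_mem_spaceH hv.1]
  · rw [← mul_assoc, sq (stokesEig L k)]
    exact mul_le_mul_of_nonneg_right (mul_le_mul_of_nonneg_right (stokesEig_ge hk)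
      (stokesEig_nonneg k)) (coefSq_nonneg v k)

/-- Agmon's inequality for the sum of the Fourier coefficients. -/
lemma sum_norm_fcoef_sq_le {w : Field2 L} (hw : w ∈ stokesDomain L 1)
    (hpos : 0 < stokesNorm L (1 / 2) w) (j : Fin 3) (s : Finset (Fin 3 → ℤ)) :
    (∑ k ∈ s, ‖fcoef L w k j‖) ^ 2 ≤
      104 / (2 * Real.pi) ^ 3 * (stokesNorm L (1 / 2) w * stokesNorm L 1 w) := by
  set c : ℝ := 2 * Real.pi / L with hc
  have hc0 : 0 < c := wavenumber_pos
  set X := stokesNorm L (1 / 2) w with hX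
  set Y := stokesNorm L 1 w with hY
  have hL0 := hL.out
  have hY0 : 0 < Y := by
    have h1 := stokesNorm_half_le_one hw
    have h2 : 0 < Y ^ 2 := lt_of_lt_of_le (by positivity) h1
    exact (stokesNorm_nonneg 1 w).lt_of_ne' (pow_ne_zero_iff two_ne_zero |>.1 h2.ne')
  -- This value of `r` makes the two parts of the weight `freqSq² + r² freqSq` contribute equally to
  -- the bound `h2`.
  set r : ℝ := Y / (c * X) with hr
  have hr0 : 0 < r := by positivity
  -- Cauchy-Schwarz with the weight `freqSq (freqSq + r²)`: one factor is the lattice sum, the other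
  -- is controlled by `X` and `Y`.
  have h1 := Finset.sum_sq_le_sum_mul_sum_of_sq_le_mul s
    (r := fun k => ‖fcoef L w k j‖)
    (f := fun k => 1 / (freqSq k * (freqSq k + r ^ 2)))
    (g := fun k => freqSq k * (freqSq k + r ^ 2) * ‖fcoef L w k j‖ ^ 2)
    (fun k _ => by have := freqSq_nonneg k; positivity)
    (fun k _ => by have := freqSq_nonneg k; positivity)
    (fun k _ => by
      by_cases hk : k = 0
      · simp [hk, fcoef_zero_of_mem_spaceH hw.1]
      · have := one_le_freqSq hk
        have : 0 < freqSq k := by linarith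
        refine le_of_eq ?_
        field_simp)
  have h2 : ∑ k ∈ s, freqSq k * (freqSq k + r ^ 2) * ‖fcoef L w k j‖ ^ 2 ≤
      2 * Y ^ 2 / (c ^ 4 * L ^ 3) := by
    have hS1 := summable_stokesEig_mul_coefSq (stokesDomain_mono (by norm_num) hw)
    have hS2 := summable_stokesEig_sq_mul_coefSq hw
    have hX2 : ∑' k, stokesEig L k * coefSq w k = X ^ 2 / L ^ 3 := by
      rw [hX, stokesNorm_half_sq]
      field_simp
    have hY2 : ∑' k, stokesEig L k ^ 2 * coefSq w k = Y ^ 2 / L ^ 3 := by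
      rw [hY, stokesNorm_one_sq]
      field_simp
    have hS := (hS2.mul_left (1 / c ^ 4)).add (hS1.mul_left (r ^ 2 / c ^ 2))
    have hle : ∀ k, freqSq k * (freqSq k + r ^ 2) * ‖fcoef L w k j‖ ^ 2 ≤
        1 / c ^ 4 * (stokesEig L k ^ 2 * coefSq w k) +
          r ^ 2 / c ^ 2 * (stokesEig L k * coefSq w k) := by
      intro k
      have e : 1 / c ^ 4 * (stokesEig L k ^ 2 * coefSq w k) +
          r ^ 2 / c ^ 2 * (stokesEig L k * coefSq w k) =
          freqSq k * (freqSq k + r ^ 2) * coefSq w k := by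
        rw [stokesEig_eq, ← hc]
        field_simp
      rw [e]
      have := freqSq_nonneg k
      exact mul_le_mul_of_nonneg_left (norm_sq_fcoef_le_coefSq w k j) (by positivity)
    calc _ ≤ ∑ k ∈ s, (1 / c ^ 4 * (stokesEig L k ^ 2 * coefSq w k) +
          r ^ 2 / c ^ 2 * (stokesEig L k * coefSq w k)) := Finset.sum_le_sum fun k _ => hle k
      _ ≤ ∑' k, (1 / c ^ 4 * (stokesEig L k ^ 2 * coefSq w k) +
          r ^ 2 / c ^ 2 * (stokesEig L k * coefSq w k)) := by
        refine hS.sum_le_tsum s fun k _ => ?_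
        have := stokesEig_nonneg (L := L) k
        have := coefSq_nonneg w k
        positivity
      _ = 1 / c ^ 4 * (Y ^ 2 / L ^ 3) + r ^ 2 / c ^ 2 * (X ^ 2 / L ^ 3) := by
        rw [(hS2.mul_left (1 / c ^ 4)).tsum_add (hS1.mul_left (r ^ 2 / c ^ 2)), tsum_mul_left,
          tsum_mul_left, hX2, hY2]
      _ = 2 * Y ^ 2 / (c ^ 4 * L ^ 3) := by
        rw [hr]
        field_simp
        ring
  refine h1.trans ((mul_le_mul (sum_lattice_le hr0 s) h2 (Finset.sum_nonneg fun k _ => by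
    have := freqSq_nonneg k; positivity) (by positivity)).trans_eq ?_)
  -- The period enters only through `c * L`, hence cancels; `104 = 52 * 2`.
  have : c * L = 2 * Real.pi := by rw [hc]; field_simp
  rw [← this, hr]
  field_simp
  ring

lemma norm_sq_eq_sum_sq (x : EuclideanSpace ℝ (Fin 3)) : ‖x‖ ^ 2 = ∑ j, x j ^ 2 := by
  simp [EuclideanSpace.norm_sq_eq]

/-- Agmon's inequality with a constant that does not depend on the period. -/
theorem isAgmonConstant_two (L : ℝ) [hL : Fact (0 < L)] : IsAgmonConstant L 2 := by
  refine ⟨two_pos, fun w hw => ?_⟩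
  -- The choice of `r` above requires `X > 0`; if `X = 0`, Poincaré forces `w = 0`.
  rcases (stokesNorm_nonneg (1 / 2) w).eq_or_lt with hX | hX
  · have h1 := poincare (stokesDomain_mono (by norm_num) hw : w ∈ stokesDomain L (1 / 2))
    rw [← hX] at h1
    have h2 : ‖w‖ ^ 2 ≤ 0 := by
      have := pow_pos (wavenumber_pos (L := L)) 2
      by_contra! h
      have := mul_pos this h
      norm_num at h1
      linarith
    have h3 : w = 0 := by
      rw [← norm_eq_zero, ← sq_eq_zero_iff]
      exact le_antisymm h2 (sq_nonneg _)
    rw [h3]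
    filter_upwards [Lp.coeFn_zero (EuclideanSpace ℝ (Fin 3)) 2 (volume : Measure (Box L))] with x hx
    rw [hx]
    simp only [Pi.zero_apply, norm_zero]
    have := stokesNorm_nonneg (1 / 2) (0 : Field2 L)
    have := stokesNorm_nonneg 1 (0 : Field2 L)
    positivity
  · set X := stokesNorm L (1 / 2) w
    set Y := stokesNorm L 1 w
    have hY : 0 ≤ Y := stokesNorm_nonneg 1 w
    set D : ℝ := 104 / (2 * Real.pi) ^ 3 * (X * Y) with hD
    have hfin : ∀ j s, ∑ k ∈ s, ‖fcoef L w k j‖ ≤ Real.sqrt D := fun j s =>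
      Real.le_sqrt_of_sq_le (sum_norm_fcoef_sq_le hw hX j s)
    have hsum : ∀ j, Summable fun k => ‖fcoef L w k j‖ := fun j =>
      summable_of_sum_le (fun _ => norm_nonneg _) (hfin j)
    have hj : ∀ j, ∀ᵐ x : Box L, |w x j| ≤ Real.sqrt D := by
      intro j
      filter_upwards [ae_abs_le_tsum_norm_fcoef w j (hsum j)] with x hx
      exact hx.trans (Real.tsum_le_of_sum_le (fun _ => norm_nonneg _) (hfin j))
    -- `104 / (2π)³ = 13 / π³` is below `4/3`; the three components then add up to at most `4 X Y`,
    -- the square of the claimed bound.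
    have hpi : D ≤ 4 / 3 * (X * Y) := by
      refine mul_le_mul_of_nonneg_right ?_ (by positivity)
      rw [div_le_div_iff₀ (by positivity) (by norm_num)]
      have : (3 : ℝ) ^ 3 ≤ Real.pi ^ 3 := pow_le_pow_left₀ (by norm_num) Real.pi_gt_three.le 3
      nlinarith
    filter_upwards [ae_all_iff.2 hj] with x hx
    refine le_of_sq_le_sq ?_ (by positivity)
    have hsq : ∀ j, w x j ^ 2 ≤ D := by
      intro j
      rw [← sq_abs, ← Real.sq_sqrt (show 0 ≤ D by positivity)]
      exact pow_le_pow_left₀ (abs_nonneg _) (hx j) 2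
    have hrt : ∀ a : ℝ, 0 ≤ a → (a ^ (1 / 2 : ℝ)) ^ 2 = a := fun a ha => by
      rw [← Real.sqrt_eq_rpow, Real.sq_sqrt ha]
    rw [mul_pow, mul_pow, hrt X hX.le, hrt Y hY, norm_sq_eq_sum_sq]
    calc ∑ j, w x j ^ 2 ≤ ∑ _j : Fin 3, D := Finset.sum_le_sum fun j _ => hsq j
      _ = 3 * D := by simp
      _ ≤ 2 ^ 2 * X * Y := by linarith

end StokesNorms

/-! ### Real analysis: ancient decay, time cut-offs in energy inequalities and weak formulations. -/

section RealAnalysis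

open Filter Topology

lemma integral_eq_intervalIntegral_of_support {T : ℝ} (hT : 0 ≤ T) {h : ℝ → ℝ}
    (hh : ∀ t, t ∉ Icc 0 T → h t = 0) : ∫ t, h t = ∫ t in (0 : ℝ)..T, h t := by
  rw [intervalIntegral.integral_of_le hT, ← integral_Icc_eq_integral_Ioc,
    setIntegral_eq_integral_of_forall_compl_eq_zero hh]

/-- Integration by parts against the primitive of an integrable function. -/
lemma integral_contDiff_mul_eq {a b : ℝ} {φ g : ℝ → ℝ} (hφ : ContDiff ℝ 1 φ)
    (hg : IntervalIntegrable g volume a b) :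
    ∫ t in a..b, φ t * g t =
      φ b * (∫ t in a..b, g t) - ∫ t in a..b, deriv φ t * ∫ s in a..t, g s := by
  have h1 : AbsolutelyContinuousOnInterval φ a b :=
    hφ.contDiffOn.absolutelyContinuousOnInterval
  have h2 : AbsolutelyContinuousOnInterval (fun x => ∫ s in a..x, g s) a b :=
    hg.absolutelyContinuousOnInterval_intervalIntegral (c := a) (by simp)
  have h3 := h1.integral_mul_deriv_eq_deriv_mul h2
  simp only [intervalIntegral.integral_same, mul_zero, sub_zero] at h3
  rw [← h3]
  apply intervalIntegral.integral_congr_ae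
  filter_upwards [hg.ae_hasDerivAt_integral] with x hx hx'
  rw [(hx (uIoc_subset_uIcc hx') a (by simp)).deriv]

/-- A function that is bounded above and dissipated at the rate `a` since `-∞` is nonpositive. -/
lemma nonpos_of_ancient_decay {z : ℝ → ℝ} {a M : ℝ} (ha : 0 < a)
    (hz : ∀ s t, IntervalIntegrable z volume s t) (hM : ∀ᵐ t, z t ≤ M)
    (hdec : ∀ᵐ s, ∀ t, s ≤ t → z t + a * (∫ r in s..t, z r) ≤ z s) (t₀ : ℝ) : z t₀ ≤ 0 := by
  by_contra! hz0
  -- The decay holds only from almost every starting time `s`, so it is averaged over `s` in `[t₀ -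
  -- x/a, t₀]` with weight `exp (a (s - t₀))`. Integration by parts cancels the weighted primitives
  -- of `z` and leaves `z t₀ (exp x - 1) ≤ M x`; then `exp x ≥ 1 + x + x²/2`.
  have key : ∀ x : ℝ, 0 < x → z t₀ * (1 + x / 2) ≤ M := by
    intro x hx
    have hxa : 0 < x / a := by positivity
    set S := t₀ - x / a with hS
    have hSt : S ≤ t₀ := by linarith
    let φ : ℝ → ℝ := fun s => Real.exp (a * (s - t₀))
    have hφd : ∀ s, HasDerivAt φ (φ s * a) s := fun s => by
      have := (((hasDerivAt_id s).sub_const t₀).const_mul a).exp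
      simpa using this
    have hφ : ContDiff ℝ 1 φ := by fun_prop
    have hφc : Continuous φ := hφ.continuous
    have hφt : φ t₀ = 1 := by simp [φ]
    have hφS : φ S = Real.exp (-x) := by
      simp only [φ, hS]
      congr 1
      field_simp
      ring
    set G := ∫ r in S..t₀, z r with hG
    have hprim : Continuous fun s => ∫ r in S..s, z r :=
      intervalIntegral.continuous_primitive hz S
    have hibp := integral_contDiff_mul_eq hφ (hz S t₀)
    simp only [(hφd _).deriv, hφt, one_mul] at hibp
    have hφint : ∫ s in S..t₀, φ s = (1 - Real.exp (-x)) / a := by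
      have h := intervalIntegral.integral_eq_sub_of_hasDerivAt (a := S) (b := t₀)
        (fun s _ => hφd s) ((hφc.mul continuous_const).intervalIntegrable _ _)
      rw [intervalIntegral.integral_mul_const, hφt, hφS] at h
      rw [← h]
      field_simp
    have h1 : ∫ s in S..t₀, φ s * (z t₀ + a * (G - ∫ r in S..s, z r)) ≤
        ∫ s in S..t₀, φ s * z s := by
      refine intervalIntegral.integral_mono_ae_restrict hSt ?_ ?_ ?_
      · exact Continuous.intervalIntegrable (by fun_prop) _ _
      · exact (hz S t₀).continuousOn_mul hφc.continuousOn
      · filter_upwards [ae_restrict_of_ae hdec, ae_restrict_mem measurableSet_Icc] with s hs hs'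
        refine mul_le_mul_of_nonneg_left ?_ (Real.exp_pos _).le
        have : G - ∫ r in S..s, z r = ∫ r in s..t₀, z r :=
          intervalIntegral.integral_interval_sub_left (hz _ _) (hz _ _)
        rw [this]
        exact hs t₀ hs'.2
    have h2 : ∫ s in S..t₀, φ s * (z t₀ + a * (G - ∫ r in S..s, z r)) =
        (z t₀ + a * G) * ((1 - Real.exp (-x)) / a) -
          ∫ s in S..t₀, φ s * a * ∫ r in S..s, z r := by
      rw [← hφint, ← intervalIntegral.integral_const_mul, ← intervalIntegral.integral_sub]
      · congr 1
        ext s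
        ring
      · exact Continuous.intervalIntegrable (by fun_prop) _ _
      · exact Continuous.intervalIntegrable (by fun_prop) _ _
    have h3 : G ≤ M * (x / a) := by
      have := intervalIntegral.integral_mono_ae_restrict (μ := volume) hSt (hz S t₀)
        (intervalIntegrable_const (c := M)) (ae_restrict_of_ae hM)
      rw [intervalIntegral.integral_const, smul_eq_mul] at this
      rw [hG]
      refine this.trans_eq ?_
      rw [hS]
      ring
    have h4 : z t₀ * (1 - Real.exp (-x)) ≤ Real.exp (-x) * (M * x) := by
      have e1 : (z t₀ + a * G) * ((1 - Real.exp (-x)) / a) - G ≤ 0 := by linarith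
      have e2 : (z t₀ + a * G) * ((1 - Real.exp (-x)) / a) - G =
          (z t₀ * (1 - Real.exp (-x)) - Real.exp (-x) * (a * G)) / a := by
        field_simp
        ring
      rw [e2] at e1
      have e3 : z t₀ * (1 - Real.exp (-x)) - Real.exp (-x) * (a * G) ≤ 0 := by
        by_contra! h
        exact absurd e1 (not_le.2 (div_pos h ha))
      have e4 : a * G ≤ M * x := by
        calc a * G ≤ a * (M * (x / a)) := mul_le_mul_of_nonneg_left h3 ha.le
          _ = M * x := by field_simp
      have := mul_le_mul_of_nonneg_left e4 (Real.exp_pos (-x)).le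
      linarith
    have h5 : z t₀ * (Real.exp x - 1) ≤ M * x := by
      have e : Real.exp (-x) * Real.exp x = 1 := by rw [← Real.exp_add]; simp
      calc z t₀ * (Real.exp x - 1) = z t₀ * (Real.exp x - Real.exp (-x) * Real.exp x) := by rw [e]
        _ = z t₀ * (1 - Real.exp (-x)) * Real.exp x := by ring
        _ ≤ Real.exp (-x) * (M * x) * Real.exp x :=
          mul_le_mul_of_nonneg_right h4 (Real.exp_pos x).le
        _ = M * x * (Real.exp (-x) * Real.exp x) := by ring
        _ = M * x := by rw [e, mul_one]
    have h6 := mul_le_mul_of_nonneg_left (Real.quadratic_le_exp_of_nonneg hx.le) hz0.le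
    refine le_of_mul_le_mul_right ?_ hx
    linarith
  -- This `x` turns the bound into `z t₀ + |M| + 1 ≤ M`, which is absurd.
  have h := key (2 * (|M| + 1) / z t₀) (by positivity)
  have e : z t₀ * (1 + 2 * (|M| + 1) / z t₀ / 2) = z t₀ + (|M| + 1) := by
    field_simp
  rw [e] at h
  linarith [le_abs_self M]

/-- An energy inequality from almost every initial time, localised by a cut-off in time. -/
lemma localized_energy_le {T C : ℝ} (hT : 0 < T) {E g η : ℝ → ℝ} (hη : ContDiff ℝ 1 η)
    (hη0 : ∀ t, 0 ≤ η t) (hsupp : ∀ t, t ∉ Icc 0 T → η t = 0) (hC : ∀ t, |deriv η t| ≤ C)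
    (hE : IntegrableOn E (Icc 0 (T + 1))) (hg : IntegrableOn g (Icc 0 (T + 1)))
    (hineq : ∀ᵐ s ∂(volume.restrict (Ici (0 : ℝ))), ∀ t, s ≤ t →
      ∫ r in s..t, g r ≤ E s - E t) :
    ∫ t in (0 : ℝ)..T, η t * g t ≤ ∫ t in (0 : ℝ)..T, deriv η t * E t := by
  have hT1 : (0 : ℝ) ≤ T + 1 := by linarith
  have hgi : ∀ a ∈ Icc 0 (T + 1), ∀ b ∈ Icc 0 (T + 1), IntervalIntegrable g volume a b := by
    intro a ha b hb
    have h01 : IntervalIntegrable g volume 0 (T + 1) :=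
      (intervalIntegrable_iff_integrableOn_Icc_of_le hT1).2 hg
    exact h01.mono_set (by rw [uIcc_of_le hT1]; exact uIcc_subset_Icc ha hb)
  have h0mem : (0 : ℝ) ∈ Icc 0 (T + 1) := ⟨le_rfl, hT1⟩
  have hTmem : T ∈ Icc 0 (T + 1) := ⟨hT.le, by linarith⟩
  set P : ℝ → ℝ := fun t => ∫ r in (0 : ℝ)..t, g r with hP
  have hPc : ContinuousOn P (Icc 0 (T + 1)) := by
    have := intervalIntegral.continuousOn_primitive_interval (μ := volume) (f := g)
      (a := 0) (b := T + 1) (by rwa [uIcc_of_le hT1])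
    rwa [uIcc_of_le hT1] at this
  -- The energy inequality says that `E + P` does not increase from almost every starting time. The
  -- margin `1` beyond `T` leaves room for forward shifts.
  set F : ℝ → ℝ := (Icc 0 (T + 1)).indicator fun t => E t + P t with hF
  have hFint : Integrable F :=
    (hE.add (hPc.integrableOn_compact isCompact_Icc)).integrable_indicator measurableSet_Icc
  have hanti : ∀ᵐ s, s ∈ Icc 0 T → ∀ h ∈ Icc (0 : ℝ) 1, F (s + h) ≤ F s := by
    rw [ae_restrict_iff' measurableSet_Ici] at hineq
    filter_upwards [hineq] with s hs hsT h hh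
    have h1 : s ∈ Icc 0 (T + 1) := ⟨hsT.1, by linarith [hsT.2]⟩
    have h2 : s + h ∈ Icc 0 (T + 1) := ⟨by linarith [hsT.1, hh.1], by linarith [hsT.2, hh.2]⟩
    rw [hF, indicator_of_mem h1, indicator_of_mem h2]
    have h3 := hs hsT.1 (s + h) (by linarith [hh.1])
    have h4 : (∫ r in (0 : ℝ)..(s + h), g r) - ∫ r in (0 : ℝ)..s, g r = ∫ r in s..(s + h), g r :=
      intervalIntegral.integral_interval_sub_left (hgi _ h0mem _ h2) (hgi _ h0mem _ h1)
    simp only [hP]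
    linarith
  have hlip : ∀ t h : ℝ, |η (t + h) - η t| ≤ C * |h| := by
    intro t h
    have := convex_univ.norm_image_sub_le_of_norm_deriv_le (f := η) (C := C) (x := t) (y := t + h)
      (fun x _ => hη.differentiable (by norm_num) x) (fun x _ => by simpa using hC x)
      trivial trivial
    simpa using this
  have hηb : ∃ B, ∀ t, ‖η t‖ ≤ B :=
    (HasCompactSupport.intro isCompact_Icc hsupp).exists_bound_of_continuous hη.continuous
  obtain ⟨B, hB⟩ := hηb
  have hηF : ∀ h : ℝ, Integrable fun t => η (t + h) * F t := fun h =>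
    hFint.bdd_mul (c := B) (hη.continuous.comp (by fun_prop)).aestronglyMeasurable
      (.of_forall fun t => hB _)
  -- `F` is not differentiated: `∫ η' F` is the limit of difference quotients of `η`. Translation
  -- moves a negative step onto `F`, where it becomes a forward shift, and monotonicity gives the
  -- sign.
  let h : ℕ → ℝ := fun n => -(1 / ((n : ℝ) + 1))
  have hneg : ∀ n, h n < 0 := fun n => neg_neg_of_pos (by positivity)
  have hone : ∀ n, -h n ∈ Icc (0 : ℝ) 1 := fun n => by
    refine ⟨by linarith [hneg n], ?_⟩
    simp only [h, neg_neg]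
    rw [div_le_one (by positivity)]
    have : (0 : ℝ) ≤ n := Nat.cast_nonneg n
    linarith
  have hlim : Tendsto h atTop (𝓝[≠] 0) := by
    refine tendsto_nhdsWithin_iff.2 ⟨?_, .of_forall fun n => (hneg n).ne⟩
    have := (tendsto_one_div_add_atTop_nhds_zero_nat (𝕜 := ℝ)).neg
    rw [neg_zero] at this
    exact this
  have hconv : Tendsto (fun n => ∫ t, (h n)⁻¹ * (η (t + h n) - η t) * F t) atTop
      (𝓝 (∫ t, deriv η t * F t)) := by
    refine tendsto_integral_of_dominated_convergence (fun t => C * ‖F t‖) ?_ ?_ ?_ ?_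
    · intro n
      refine AEStronglyMeasurable.mul ?_ hFint.aestronglyMeasurable
      have := hη.continuous
      exact Continuous.aestronglyMeasurable (by fun_prop)
    · exact hFint.norm.const_mul C
    · intro n
      refine .of_forall fun t => ?_
      rw [norm_mul]
      refine mul_le_mul_of_nonneg_right ?_ (norm_nonneg _)
      rw [norm_mul, norm_inv, Real.norm_eq_abs, Real.norm_eq_abs, inv_mul_le_iff₀
        (abs_pos.2 (hneg n).ne), mul_comm]
      exact hlip _ _
    · refine .of_forall fun t => ?_
      have hd := (hη.differentiable (by norm_num) t).hasDerivAt.tendsto_slope_zero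
      have := (hd.comp hlim).mul_const (F t)
      simpa [Function.comp_def] using this
  have hnonneg : ∀ n, 0 ≤ ∫ t, (h n)⁻¹ * (η (t + h n) - η t) * F t := by
    intro n
    have e1 : ∫ t, (h n)⁻¹ * (η (t + h n) - η t) * F t =
        (h n)⁻¹ * ((∫ t, η (t + h n) * F t) - ∫ t, η t * F t) := by
      have h0 := hηF 0
      simp only [add_zero] at h0
      rw [← integral_sub (hηF _) h0, ← integral_const_mul]
      congr 1
      ext t
      ring
    have e2 : ∫ t, η (t + h n) * F t = ∫ t, η t * F (t + -h n) := by
      rw [← integral_add_right_eq_self (fun t => η (t + h n) * F t) (-h n)]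
      simp
    have hFs : Integrable fun t => η t * F (t + -h n) := by
      have := (hηF (h n)).comp_add_right (-h n)
      simpa using this
    have h0 := hηF 0
    simp only [add_zero] at h0
    rw [e1, e2, ← integral_sub hFs h0]
    refine mul_nonneg_of_nonpos_of_nonpos (inv_nonpos.2 (hneg n).le) (integral_nonpos_of_ae ?_)
    filter_upwards [hanti] with t ht
    by_cases htT : t ∈ Icc 0 T
    · have := mul_le_mul_of_nonneg_left (ht htT (-h n) (hone n)) (hη0 t)
      simp only [Pi.zero_apply]
      linarith
    · simp [hsupp t htT]
  have hfinal : 0 ≤ ∫ t, deriv η t * F t := ge_of_tendsto' hconv hnonneg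
  have hd0 : ∀ t, t ∉ Icc 0 T → deriv η t = 0 := by
    intro t ht
    have : η =ᶠ[𝓝 t] fun _ => 0 := by
      filter_upwards [isClosed_Icc.isOpen_compl.mem_nhds ht] with s hs
      exact hsupp s hs
    rw [this.deriv_eq, deriv_const]
  rw [integral_eq_intervalIntegral_of_support hT.le
    (fun t ht => by rw [hd0 t ht, zero_mul])] at hfinal
  have hsub : Icc 0 T ⊆ Icc 0 (T + 1) := Icc_subset_Icc_right (by linarith)
  have hdc : Continuous (deriv η) := hη.continuous_deriv (by norm_num)
  have e3 : ∫ t in (0 : ℝ)..T, deriv η t * F t =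
      (∫ t in (0 : ℝ)..T, deriv η t * E t) + ∫ t in (0 : ℝ)..T, deriv η t * P t := by
    rw [← intervalIntegral.integral_add]
    · refine intervalIntegral.integral_congr fun t ht => ?_
      rw [uIcc_of_le hT.le] at ht
      simp only [hF, indicator_of_mem (hsub ht)]
      ring
    · refine IntervalIntegrable.continuousOn_mul ?_ hdc.continuousOn
      exact (intervalIntegrable_iff_integrableOn_Icc_of_le hT.le).2 (hE.mono_set hsub)
    · refine ContinuousOn.intervalIntegrable ?_
      rw [uIcc_of_le hT.le]
      exact hdc.continuousOn.mul (hPc.mono hsub)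
  have hηT : η T = 0 := by
    have h1 : Tendsto η (𝓝[>] T) (𝓝 (η T)) := hη.continuous.continuousAt.mono_left inf_le_left
    have h2 : Tendsto η (𝓝[>] T) (𝓝 0) := by
      refine tendsto_const_nhds.congr' ?_
      filter_upwards [self_mem_nhdsWithin] with t ht
      exact (hsupp t fun h => absurd h.2 (not_le.2 ht)).symm
    exact tendsto_nhds_unique h1 h2
  -- The part `∫ η' P` of `∫ η' F` equals `-∫ η g`, since `η T = 0`.
  have e4 := integral_contDiff_mul_eq hη (hgi 0 h0mem T hTmem)
  rw [hηT, zero_mul, zero_sub] at e4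
  linarith

open scoped Convolution in
/-- A weak formulation in the open half-line extends to `C¹` cut-offs that vanish at time zero. -/
lemma weak_form_of_contDiff_one {T : ℝ} {p q η : ℝ → ℝ} (hη : ContDiff ℝ 1 η)
    (hsupp : ∀ t, t ∉ Icc 0 T → η t = 0)
    (hp : IntegrableOn p (Icc 0 (T + 1))) (hq : IntegrableOn q (Icc 0 (T + 1)))
    (hweak : ∀ φ : ℝ → ℝ, ContDiff ℝ ∞ φ → HasCompactSupport φ → tsupport φ ⊆ Ioi 0 →
      ∫ t, (-(deriv φ t * p t) + φ t * q t) = 0) :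
    ∫ t, (-(deriv η t * p t) + η t * q t) = 0 := by
  have hηc : HasCompactSupport η := HasCompactSupport.intro isCompact_Icc hsupp
  have hdc : Continuous (deriv η) := hη.continuous_deriv (by norm_num)
  obtain ⟨B, hB⟩ := hηc.exists_bound_of_continuous hη.continuous
  obtain ⟨B', hB'⟩ := hηc.deriv.exists_bound_of_continuous hdc
  -- Mollifying at scale `ε` and shifting right by `2ε` moves the support into `[ε, T + 3ε]`: inside
  -- the open half-line and, as `3ε ≤ 1`, inside `[0, T + 1]`.
  let ε : ℕ → ℝ := fun n => 1 / ((n : ℝ) + 1) / 3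
  have hε0 : ∀ n, 0 < ε n := fun n => by positivity
  have hε1 : ∀ n, 3 * ε n ≤ 1 := fun n => by
    have : (0 : ℝ) ≤ n := Nat.cast_nonneg n
    have : 1 / ((n : ℝ) + 1) ≤ 1 := by
      rw [div_le_one (by positivity)]
      linarith
    simp only [ε]
    linarith
  have hεlim : Tendsto ε atTop (𝓝 0) := by
    have := (tendsto_one_div_add_atTop_nhds_zero_nat (𝕜 := ℝ)).div_const 3
    rwa [zero_div] at this
  let ψ : ℕ → ContDiffBump (0 : ℝ) := fun n =>
    ⟨ε n / 2, ε n, half_pos (hε0 n), half_lt_self (hε0 n)⟩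
  have hψ : Tendsto (fun n => (ψ n).rOut) atTop (𝓝 0) := hεlim
  let m : (ℝ → ℝ) → ℕ → ℝ → ℝ := fun f n =>
    (ψ n).normed volume ⋆[ContinuousLinearMap.lsmul ℝ ℝ, volume] f
  have hm_bound : ∀ (f : ℝ → ℝ), Continuous f → ∀ A, (∀ t, ‖f t‖ ≤ A) → ∀ n t, ‖m f n t‖ ≤ A := by
    intro f hf A hA n t
    have := dist_convolution_le (f := (ψ n).normed volume) (g := f) (R := (ψ n).rOut) (x₀ := t)
      (ε := A) (z₀ := 0) (μ := volume) ((norm_nonneg _).trans (hA 0))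
      (ψ n).support_normed_eq.subset (ψ n).nonneg_normed (ψ n).integral_normed
      hf.aestronglyMeasurable (fun x _ => by rw [dist_zero_right]; exact hA x)
    rwa [dist_zero_right] at this
  have hm_lim : ∀ (f : ℝ → ℝ), Continuous f → ∀ t,
      Tendsto (fun n => m f n (t - 2 * ε n)) atTop (𝓝 (f t)) := by
    intro f hf t
    refine ContDiffBump.convolution_tendsto_right (g := fun _ => f) (x₀ := t) hψ
      (.of_forall fun _ => hf.aestronglyMeasurable) ?_ ?_
    · exact (hf.tendsto t).comp tendsto_snd
    · have := (hεlim.const_mul 2).const_sub t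
      simpa using this
  have hm_supp : ∀ n t, t ∉ Icc (-ε n) (T + ε n) → m η n t = 0 := by
    intro n t ht
    have := dist_convolution_le (f := (ψ n).normed volume) (g := η) (R := (ψ n).rOut) (x₀ := t)
      (ε := 0) (z₀ := 0) (μ := volume) le_rfl
      (ψ n).support_normed_eq.subset (ψ n).nonneg_normed (ψ n).integral_normed
      hη.continuous.aestronglyMeasurable (fun x hx => by
        rw [hsupp x, dist_self]
        intro hxT
        apply ht
        have hx' : |x - t| < ε n := by
          rw [← Real.dist_eq]
          exact hx
        rw [abs_lt] at hx'
        exact ⟨by linarith [hxT.1], by linarith [hxT.2]⟩)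
    exact dist_le_zero.1 this
  have hm_diff : ∀ n, ContDiff ℝ ∞ (m η n) := fun n =>
    (ψ n).hasCompactSupport_normed.contDiff_convolution_left _ (ψ n).contDiff_normed
      hη.continuous.locallyIntegrable
  have hm_deriv : ∀ n t, HasDerivAt (m η n) (m (deriv η) n t) t := fun n t =>
    hηc.hasDerivAt_convolution_right _ ((ψ n).continuous_normed.locallyIntegrable) hη t
  let φ : ℕ → ℝ → ℝ := fun n t => m η n (t - 2 * ε n)
  have hφ_deriv : ∀ n t, deriv (φ n) t = m (deriv η) n (t - 2 * ε n) := fun n t =>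
    ((hm_deriv n _).comp_sub_const t (2 * ε n)).deriv
  have hφ_supp : ∀ n t, t ∉ Icc (ε n) (T + 3 * ε n) → φ n t = 0 := by
    intro n t ht
    refine hm_supp n _ fun h => ht ⟨by linarith [h.1], by linarith [h.2]⟩
  have hφ_diff : ∀ n, ContDiff ℝ ∞ (φ n) := fun n =>
    (hm_diff n).comp (contDiff_id.sub contDiff_const)
  have hφ_tsupp : ∀ n, tsupport (φ n) ⊆ Icc (ε n) (T + 3 * ε n) := fun n =>
    closure_minimal (fun t ht => by
      by_contra h
      exact ht (hφ_supp n t h)) isClosed_Icc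
  have hφ_zero : ∀ n, ∫ t, (-(deriv (φ n) t * p t) + φ n t * q t) = 0 := fun n =>
    hweak _ (hφ_diff n) (HasCompactSupport.intro isCompact_Icc (hφ_supp n))
      ((hφ_tsupp n).trans fun t ht => (hε0 n).trans_le ht.1)
  have hφ_dsupp : ∀ n t, t ∉ Icc (ε n) (T + 3 * ε n) → deriv (φ n) t = 0 := fun n t ht =>
    image_eq_zero_of_notMem_tsupport fun h => ht (hφ_tsupp n (tsupport_deriv_subset h))
  have hηd : ∀ t, t ∉ Icc 0 T → deriv η t = 0 := fun t ht =>
    image_eq_zero_of_notMem_tsupport fun h => ht (closure_minimal (fun t ht => by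
      by_contra h
      exact ht (hsupp t h)) isClosed_Icc (tsupport_deriv_subset h))
  set p' := (Icc 0 (T + 1)).indicator p with hp'
  set q' := (Icc 0 (T + 1)).indicator q with hq'
  have hp'i : Integrable p' := hp.integrable_indicator measurableSet_Icc
  have hq'i : Integrable q' := hq.integrable_indicator measurableSet_Icc
  have hcut : ∀ a b : ℝ → ℝ, (∀ t, t ∉ Icc 0 (T + 1) → a t = 0) →
      (∀ t, t ∉ Icc 0 (T + 1) → b t = 0) → ∀ t,
      -(a t * p t) + b t * q t = -(a t * p' t) + b t * q' t := by
    intro a b ha hb t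
    by_cases ht : t ∈ Icc 0 (T + 1)
    · rw [hp', hq', indicator_of_mem ht, indicator_of_mem ht]
    · rw [ha t ht, hb t ht]
      ring
  have hsub : Icc 0 T ⊆ Icc 0 (T + 1) := Icc_subset_Icc_right (by linarith)
  have hsubn : ∀ n, Icc (ε n) (T + 3 * ε n) ⊆ Icc 0 (T + 1) := fun n =>
    Icc_subset_Icc (hε0 n).le (by linarith [hε1 n])
  have hconv : Tendsto (fun n => ∫ t, (-(deriv (φ n) t * p' t) + φ n t * q' t)) atTop
      (𝓝 (∫ t, (-(deriv η t * p' t) + η t * q' t))) := by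
    refine tendsto_integral_of_dominated_convergence
      (fun t => B' * ‖p' t‖ + B * ‖q' t‖) ?_ ?_ ?_ ?_
    · intro n
      have h1 : Continuous (φ n) := (hφ_diff n).continuous
      have h2 : Continuous (deriv (φ n)) := (hφ_diff n).continuous_deriv (by norm_num)
      exact (h2.aestronglyMeasurable.mul hp'i.aestronglyMeasurable).neg.add
        (h1.aestronglyMeasurable.mul hq'i.aestronglyMeasurable)
    · exact (hp'i.norm.const_mul B').add (hq'i.norm.const_mul B)
    · intro n
      refine .of_forall fun t => (norm_add_le _ _).trans ?_
      rw [norm_neg, norm_mul, norm_mul, hφ_deriv]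
      gcongr
      · exact hm_bound _ hdc _ hB' n _
      · exact hm_bound _ hη.continuous _ hB n _
    · refine .of_forall fun t => ?_
      simp only [hφ_deriv]
      exact (((hm_lim _ hdc t).mul_const _).neg).add ((hm_lim _ hη.continuous t).mul_const _)
  have e : ∀ n, ∫ t, (-(deriv (φ n) t * p' t) + φ n t * q' t) = 0 := by
    intro n
    rw [← hφ_zero n]
    congr 1
    ext t
    exact (hcut _ _ (fun t ht => hφ_dsupp n t fun h => ht (hsubn n h))
      (fun t ht => hφ_supp n t fun h => ht (hsubn n h)) t).symm
  simp only [e] at hconv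
  have hfin := tendsto_nhds_unique hconv tendsto_const_nhds
  rw [← hfin]
  congr 1
  ext t
  exact hcut _ _ (fun t ht => hηd t fun h => ht (hsub h))
    (fun t ht => hsupp t fun h => ht (hsub h)) t

end RealAnalysis

/-! ### Leray-Hopf solutions: absorbing ball and localised energy inequality. -/

section LerayHopf

open Filter Topology

variable {L : ℝ} [hL : Fact (0 < L)] {ν : ℝ} {f : Field2 L} {I : Set ℝ} {u : ℝ → Field2 L}

lemma IsLerayHopf.exists_ae_norm_le (hu : IsLerayHopf L ν f I u) :
    ∃ M : ℝ, 0 ≤ M ∧ ∀ᵐ t ∂(volume.restrict I), ‖u t‖ ≤ M := by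
  refine ⟨(eLpNorm u ⊤ (volume.restrict I)).toReal, ENNReal.toReal_nonneg, ?_⟩
  have h := hu.bounded.eLpNorm_lt_top
  rw [eLpNorm_exponent_top] at h ⊢
  filter_upwards [ae_le_eLpNormEssSup (f := u) (μ := volume.restrict I)] with t ht
  rw [← toReal_enorm]
  exact ENNReal.toReal_mono h.ne ht

/-- A continuous function of quadratic growth along the solution is integrable on bounded sets. -/
lemma IsLerayHopf.integrableOn_comp (hu : IsLerayHopf L ν f I u) {Q : Field2 L → ℝ}
    (hQ : Continuous Q) {C : ℝ} (hC : ∀ v, |Q v| ≤ C * (1 + ‖v‖ ^ 2)) {J : Set ℝ}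
    (hJI : J ⊆ I) (hJ : volume J ≠ ⊤) :
    IntegrableOn (fun t => Q (u t)) J := by
  obtain ⟨M, hM0, hM⟩ := hu.exists_ae_norm_le
  have hmeas : AEStronglyMeasurable (fun t => Q (u t)) (volume.restrict J) :=
    hQ.comp_aestronglyMeasurable (hu.bounded.aestronglyMeasurable.mono_set hJI)
  refine IntegrableOn.of_bound (lt_top_iff_ne_top.2 hJ) hmeas (|C| * (1 + M ^ 2)) ?_
  filter_upwards [ae_restrict_of_ae_restrict_of_subset hJI hM] with t ht
  rw [Real.norm_eq_abs]
  refine (hC _).trans ((mul_le_mul_of_nonneg_right (le_abs_self C) (by positivity)).trans ?_)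
  gcongr

lemma IsLerayHopf.integrableOn_norm_sq (hu : IsLerayHopf L ν f I u) {J : Set ℝ}
    (hJI : J ⊆ I) (hJ : volume J ≠ ⊤) : IntegrableOn (fun t => ‖u t‖ ^ 2) J :=
  hu.integrableOn_comp (Q := fun v => ‖v‖ ^ 2) (by fun_prop) (C := 1)
    (fun v => by rw [abs_of_nonneg (sq_nonneg _), one_mul]; linarith) hJI hJ

lemma IsLerayHopf.integrableOn_norm (hu : IsLerayHopf L ν f I u) {J : Set ℝ}
    (hJI : J ⊆ I) (hJ : volume J ≠ ⊤) : IntegrableOn (fun t => ‖u t‖) J :=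
  hu.integrableOn_comp (Q := fun v => ‖v‖) (by fun_prop) (C := 1)
    (fun v => by rw [abs_of_nonneg (norm_nonneg _)]; nlinarith [sq_nonneg (‖v‖ - 1)]) hJI hJ

lemma IsLerayHopf.continuousOn_inner (hu : IsLerayHopf L ν f I u) (v : Field2 L) :
    ContinuousOn (fun t => inner ℝ v (u t)) I :=
  (hu.weak_cont v).congr fun _ _ => real_inner_comm _ _

/-- The weak attractor is contained in the absorbing ball. -/
theorem norm_le_of_mem_weakAttractor (hν : 0 < ν) {v : Field2 L}
    (hv : v ∈ weakAttractor L ν f) :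
    ‖v‖ ≤ ‖f‖ / (ν * (2 * Real.pi / L) ^ 2) := by
  obtain ⟨w, hw, rfl⟩ := hv
  set lam : ℝ := (2 * Real.pi / L) ^ 2 with hlam
  have hlam0 : 0 < lam := pow_pos wavenumber_pos 2
  set a := ν * lam with ha
  have ha0 : 0 < a := by positivity
  obtain ⟨M, hM0, hM⟩ := hw.exists_ae_norm_le
  rw [Measure.restrict_univ] at hM
  have hzint : ∀ s t, IntervalIntegrable (fun t => ‖w t‖ ^ 2) volume s t := fun s t =>
    intervalIntegrable_iff.2 (hw.integrableOn_norm_sq (subset_univ _) (by simp [uIoc]))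
  have hAint : ∀ s t, IntervalIntegrable (fun t => stokesNorm L (1 / 2) (w t) ^ 2) volume s t :=
    fun s t => ((locallyIntegrableOn_univ.1 hw.sq_int).integrableOn_isCompact
      isCompact_uIcc).intervalIntegrable
  have hfint : ∀ s t, IntervalIntegrable (fun t => inner ℝ f (w t)) volume s t := fun s t =>
    (continuousOn_univ.1 (hw.continuousOn_inner f)).intervalIntegrable _ _
  -- Energy inequality, Poincaré and Young give, in integrated form, `d/dt ‖w‖² ≤ -a ‖w‖² + ‖f‖²/a`;
  -- hence `‖w‖² - (‖f‖/a)²` decays at rate `a` and has been bounded above since `-∞`.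
  have key := nonpos_of_ancient_decay (z := fun t => ‖w t‖ ^ 2 - (‖f‖ / a) ^ 2) (a := a)
    (M := M ^ 2) ha0 (fun s t => (hzint s t).sub intervalIntegrable_const) ?_ ?_ 0
  · have h1 : ‖w 0‖ ^ 2 ≤ (‖f‖ / a) ^ 2 := by linarith
    exact le_of_sq_le_sq h1 (by positivity)
  · filter_upwards [hM] with t ht
    have := pow_le_pow_left₀ (norm_nonneg _) ht 2
    have := sq_nonneg (‖f‖ / a)
    linarith
  · have hen := hw.energy_ineq
    have hV := hw.mem_V
    rw [Measure.restrict_univ] at hen hV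
    filter_upwards [hen] with s hs t hst
    have h1 : a * ∫ r in s..t, (‖w r‖ ^ 2 - (‖f‖ / a) ^ 2) ≤
        2 * (ν * ∫ r in s..t, stokesNorm L (1 / 2) (w r) ^ 2) -
          2 * ∫ r in s..t, inner ℝ f (w r) := by
      rw [← intervalIntegral.integral_const_mul, ← intervalIntegral.integral_const_mul,
        ← intervalIntegral.integral_const_mul, ← intervalIntegral.integral_const_mul,
        ← intervalIntegral.integral_sub (((hAint s t).const_mul _).const_mul _)
          ((hfint s t).const_mul _)]
      refine intervalIntegral.integral_mono_ae hst
        (((hzint s t).sub intervalIntegrable_const).const_mul _)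
        ((((hAint s t).const_mul _).const_mul _).sub ((hfint s t).const_mul _)) ?_
      filter_upwards [hV] with r hr
      have h2 := poincare hr
      rw [← hlam] at h2
      have h3 := real_inner_le_norm f (w r)
      have h4 := mul_le_mul_of_nonneg_left h2 hν.le
      have h5 : a * (‖f‖ / a) ^ 2 = ‖f‖ ^ 2 / a := by field_simp
      have h6 : 2 * (‖f‖ * ‖w r‖) ≤ a * ‖w r‖ ^ 2 + ‖f‖ ^ 2 / a := by
        have : 0 ≤ (a * ‖w r‖ - ‖f‖) ^ 2 / a := by positivity
        have e : (a * ‖w r‖ - ‖f‖) ^ 2 / a =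
            a * ‖w r‖ ^ 2 + ‖f‖ ^ 2 / a - 2 * (‖f‖ * ‖w r‖) := by
          field_simp
          ring
        linarith
      rw [← mul_assoc, ← ha] at h4
      rw [mul_sub, h5]
      linarith
    have h2 := hs t hst
    linarith

/-- The energy inequality localised in time by a cut-off. -/
theorem IsLerayHopf.localized_energy_inequality (hu : IsLerayHopf L ν f (Ici 0) u)
    {C T : ℝ} {η : ℝ → ℝ} (hT : 0 < T) (hη : ContDiff ℝ 1 η) (hη0 : ∀ t, 0 ≤ η t)
    (hsupp : ∀ t, t ∉ Icc 0 T → η t = 0) (hC : ∀ t, |deriv η t| ≤ C) :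
    ν * (∫ t in (0 : ℝ)..T, η t * stokesNorm L (1 / 2) (u t) ^ 2) ≤
      (∫ t in (0 : ℝ)..T, deriv η t * (‖u t‖ ^ 2 / 2)) +
        ∫ t in (0 : ℝ)..T, η t * inner ℝ f (u t) := by
  have hsub : Icc 0 (T + 1) ⊆ Ici (0 : ℝ) := Icc_subset_Ici_self
  have hE : IntegrableOn (fun t => ‖u t‖ ^ 2 / 2) (Icc 0 (T + 1)) :=
    (hu.integrableOn_norm_sq hsub (by simp)).div_const 2
  have hA : ∀ a b : ℝ, 0 ≤ a → IntegrableOn (fun t => stokesNorm L (1 / 2) (u t) ^ 2) (Icc a b) :=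
    fun a b ha => hu.sq_int.integrableOn_compact_subset
      (fun t ht => ha.trans ht.1) isCompact_Icc
  have hf : ∀ a b : ℝ, 0 ≤ a → IntegrableOn (fun t => inner ℝ f (u t)) (Icc a b) := fun a b ha =>
    ((hu.continuousOn_inner f).mono fun t ht => ha.trans ht.1).integrableOn_compact isCompact_Icc
  have hg : IntegrableOn (fun t => ν * stokesNorm L (1 / 2) (u t) ^ 2 - inner ℝ f (u t))
      (Icc 0 (T + 1)) :=
    ((hA 0 (T + 1) le_rfl).const_mul ν).sub (hf 0 (T + 1) le_rfl)
  have key := localized_energy_le (E := fun t => ‖u t‖ ^ 2 / 2)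
    (g := fun t => ν * stokesNorm L (1 / 2) (u t) ^ 2 - inner ℝ f (u t)) hT hη hη0 hsupp hC hE hg ?_
  · have hii : ∀ {g : ℝ → ℝ}, IntegrableOn g (Icc 0 T) →
        IntervalIntegrable (fun t => η t * g t) volume 0 T := fun hg =>
      ((intervalIntegrable_iff_integrableOn_Icc_of_le hT.le).2 hg).continuousOn_mul
        hη.continuous.continuousOn
    have e : ∫ t in (0 : ℝ)..T, η t * (ν * stokesNorm L (1 / 2) (u t) ^ 2 - inner ℝ f (u t)) =
        ν * (∫ t in (0 : ℝ)..T, η t * stokesNorm L (1 / 2) (u t) ^ 2) -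
          ∫ t in (0 : ℝ)..T, η t * inner ℝ f (u t) := by
      rw [← intervalIntegral.integral_const_mul, ← intervalIntegral.integral_sub
        ((hii (hA 0 T le_rfl)).const_mul ν) (hii (hf 0 T le_rfl))]
      congr 1
      ext t
      ring
    linarith
  · filter_upwards [hu.energy_ineq, ae_restrict_mem measurableSet_Ici] with s hs hs0 t hst
    have hi : ∀ {g : ℝ → ℝ}, IntegrableOn g (Icc s t) → IntervalIntegrable g volume s t :=
      fun hg => (intervalIntegrable_iff_integrableOn_Icc_of_le hst).2 hg
    rw [intervalIntegral.integral_sub ((hi (hA s t hs0)).const_mul ν) (hi (hf s t hs0)),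
      intervalIntegral.integral_const_mul]
    have := hs t hst
    linarith

end LerayHopf

/-! ### Fourier multipliers, the test field `A⁻¹ f` and its gradient. -/

section Multipliers

open scoped ComplexConjugate

variable {L : ℝ}

lemma freqSq_neg (k : Fin 3 → ℤ) : freqSq (-k) = freqSq k := by simp [freqSq]

lemma stokesEig_neg (k : Fin 3 → ℤ) : stokesEig L (-k) = stokesEig L k := by
  rw [stokesEig_eq, stokesEig_eq, freqSq_neg]

/-- The symbol of the weak derivative in the direction `i`. -/
noncomputable def gradSymbol (L : ℝ) (i : Fin 3) (k : Fin 3 → ℤ) : ℂ :=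
  2 * Real.pi * Complex.I * (k i : ℂ) / (L : ℂ)

lemma gradSymbol_neg (i : Fin 3) (k : Fin 3 → ℤ) :
    gradSymbol L i (-k) = conj (gradSymbol L i k) := by
  have h2 : conj (2 : ℂ) = 2 := Complex.conj_ofReal 2
  simp only [gradSymbol, Pi.neg_apply, Int.cast_neg, map_div₀, map_mul, h2, Complex.conj_ofReal,
    Complex.conj_I, map_intCast]
  ring

lemma norm_gradSymbol_sq (i : Fin 3) (k : Fin 3 → ℤ) :
    ‖gradSymbol L i k‖ ^ 2 = (2 * Real.pi / L) ^ 2 * (k i : ℝ) ^ 2 := by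
  simp only [gradSymbol, norm_div, norm_mul, Complex.norm_real, Complex.norm_I, mul_one,
    Complex.norm_intCast, Real.norm_eq_abs, Complex.norm_ofNat]
  rw [div_pow, mul_pow, mul_pow, sq_abs, sq_abs, sq_abs]
  ring

lemma sum_norm_gradSymbol_sq (k : Fin 3 → ℤ) :
    ∑ i, ‖gradSymbol L i k‖ ^ 2 = stokesEig L k := by
  simp only [norm_gradSymbol_sq, ← Finset.mul_sum]
  rfl

lemma norm_gradSymbol_sq_le (i : Fin 3) (k : Fin 3 → ℤ) :
    ‖gradSymbol L i k‖ ^ 2 ≤ stokesEig L k := by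
  rw [← sum_norm_gradSymbol_sq]
  exact Finset.single_le_sum (f := fun i => ‖gradSymbol L i k‖ ^ 2) (fun _ _ => sq_nonneg _)
    (Finset.mem_univ i)

variable [hL : Fact (0 < L)]

/-- Bounded Fourier multipliers act on square-integrable fields. -/
lemma exists_multiplier (m : (Fin 3 → ℤ) → ℂ) (hm : ∀ k, m (-k) = conj (m k)) {B : ℝ}
    (hB : ∀ k, ‖m k‖ ^ 2 ≤ B) (v : Field2 L) :
    ∃ w : Field2 L, ∀ k j, fcoef L w k j = m k * fcoef L v k j := by
  refine exists_field_of_coef _ (fun k j => by rw [hm, fcoef_neg, map_mul]) ?_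
  refine Summable.of_nonneg_of_le (fun k => Finset.sum_nonneg fun _ _ => sq_nonneg _) (fun k => ?_)
    ((summable_coefSq v).mul_left B)
  rw [coefSq, Finset.mul_sum]
  refine Finset.sum_le_sum fun j _ => ?_
  rw [norm_mul, mul_pow]
  exact mul_le_mul_of_nonneg_right (hB k) (sq_nonneg _)

lemma mem_spaceH_of_multiplier {m : (Fin 3 → ℤ) → ℂ} {v w : Field2 L}
    (h : ∀ k j, fcoef L w k j = m k * fcoef L v k j) (hv : v ∈ spaceH L) : w ∈ spaceH L := by
  refine ⟨fun k => ?_, (integral_eq_zero_iff_fcoef w).2 fun j => ?_⟩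
  · simp only [h, mul_left_comm _ (m k), ← Finset.mul_sum, hv.1 k, mul_zero]
  · rw [h, fcoef_zero_of_mem_spaceH hv, mul_zero]

lemma coefSq_of_multiplier {m : (Fin 3 → ℤ) → ℂ} {v w : Field2 L}
    (h : ∀ k j, fcoef L w k j = m k * fcoef L v k j) (k : Fin 3 → ℤ) :
    coefSq w k = ‖m k‖ ^ 2 * coefSq v k := by
  simp only [coefSq, h, norm_mul, mul_pow, Finset.mul_sum]

/-- `v = A⁻¹ f`. -/
def IsStokesInverse (L : ℝ) [Fact (0 < L)] (f v : Field2 L) : Prop :=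
  ∀ k j, fcoef L v k j = (((stokesEig L k)⁻¹ : ℝ) : ℂ) * fcoef L f k j

lemma exists_isStokesInverse (f : Field2 L) : ∃ v, IsStokesInverse L f v := by
  refine exists_multiplier (fun k => (((stokesEig L k)⁻¹ : ℝ) : ℂ))
    (fun k => by rw [stokesEig_neg, Complex.conj_ofReal])
    (B := (((2 * Real.pi / L) ^ 2)⁻¹) ^ 2) (fun k => ?_) f
  rw [Complex.norm_real, Real.norm_eq_abs, sq_abs]
  refine pow_le_pow_left₀ (inv_nonneg.2 (stokesEig_nonneg k)) ?_ 2
  -- At the zero frequency the symbol is `0⁻¹ = 0`; elsewhere the first eigenvalue bounds it.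
  by_cases hk : k = 0
  · rw [hk, stokesEig_zero, inv_zero]
    positivity
  · exact inv_anti₀ (pow_pos wavenumber_pos 2) (stokesEig_ge hk)

lemma IsStokesInverse.coefSq_eq {f v : Field2 L} (h : IsStokesInverse L f v) (k : Fin 3 → ℤ) :
    coefSq v k = ((stokesEig L k)⁻¹) ^ 2 * coefSq f k := by
  rw [coefSq_of_multiplier h, Complex.norm_real, Real.norm_eq_abs, sq_abs]

/-- The weight `λ * λ⁻² = λ⁻¹` is that of `D(A^(-1/2))`, which contains `V`. -/
lemma IsStokesInverse.mem_spaceV {f v : Field2 L} (h : IsStokesInverse L f v)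
    (hf : f ∈ spaceV L) : v ∈ spaceV L := by
  refine ⟨mem_spaceH_of_multiplier h hf.1, ?_⟩
  refine Summable.congr (stokesDomain_mono (by norm_num : (-(1 / 2) : ℝ) ≤ 1 / 2) hf).2 fun k => ?_
  change _ * coefSq f k = _ * coefSq v k
  rw [h.coefSq_eq, ← mul_assoc]
  by_cases hk : k = 0
  · simp [hk, coefSq_zero_of_mem_spaceH hf.1]
  · have := stokesEig_pos (L := L) hk
    congr 1
    norm_num
    rw [Real.rpow_neg_one]
    field_simp

/-- `‖A⁻¹ f‖`. -/
lemma IsStokesInverse.norm_eq {f v : Field2 L} (h : IsStokesInverse L f v) :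
    ‖v‖ = stokesNorm L (-1) f := by
  rw [← sq_eq_sq₀ (norm_nonneg _) (stokesNorm_nonneg _ _), stokesNorm_sq, norm_sq_eq_tsum_coefSq]
  congr 2
  ext k
  rw [h.coefSq_eq]
  congr 1
  have : (2 * (-1) : ℝ) = -(2 : ℕ) := by norm_num
  rw [this, Real.rpow_neg (stokesEig_nonneg k), Real.rpow_natCast, inv_pow]

/-- `(f, A⁻¹ f) = ‖A ^ (-1/2) f‖ ^ 2`. -/
lemma IsStokesInverse.inner_eq {f v : Field2 L} (h : IsStokesInverse L f v) :
    inner ℝ f v = stokesNorm L (-(1 / 2)) f ^ 2 := by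
  rw [stokesNorm_sq, ← (hasSum_inner_fcoef f v).tsum_eq, tsum_mul_left]
  congr 2
  ext k
  rw [coefSq, Finset.mul_sum]
  refine Finset.sum_congr rfl fun j _ => ?_
  have e : (2 * -(1 / 2) : ℝ) = -1 := by norm_num
  rw [h, map_mul, Complex.conj_ofReal, mul_left_comm, Complex.re_ofReal_mul, Complex.mul_conj,
    Complex.ofReal_re, Complex.normSq_eq_norm_sq, e, Real.rpow_neg_one]

/-- `(A ^ (1/2) w, A ^ (1/2) A⁻¹ f) = (w, f)`. -/
lemma IsStokesInverse.stokesInner_eq {f v : Field2 L} (h : IsStokesInverse L f v) {w : Field2 L}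
    (hw : w ∈ spaceH L) : stokesInner L (1 / 2) w v = inner ℝ f w := by
  rw [real_inner_comm, ← (hasSum_inner_fcoef w f).tsum_eq, tsum_mul_left, stokesInner]
  congr 2
  ext k
  rw [Finset.mul_sum]
  refine Finset.sum_congr rfl fun j _ => ?_
  by_cases hk : k = 0
  · simp [hk, fcoef_zero_of_mem_spaceH hw]
  · have := stokesEig_pos (L := L) hk
    rw [h, map_mul, Complex.conj_ofReal, mul_left_comm, Complex.re_ofReal_mul]
    norm_num
    rw [mul_inv_cancel_left₀ this.ne']

lemma IsStokesInverse.exists_gradient {f v : Field2 L} (h : IsStokesInverse L f v) :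
    ∃ G : Fin 3 → Field2 L, IsWeakGradient L v G ∧ ∀ i k j, fcoef L (G i) k j =
      gradSymbol L i k * (((stokesEig L k)⁻¹ : ℝ) : ℂ) * fcoef L f k j := by
  have key : ∀ i, ∃ w : Field2 L, ∀ k j, fcoef L w k j =
      gradSymbol L i k * (((stokesEig L k)⁻¹ : ℝ) : ℂ) * fcoef L f k j := by
    intro i
    refine exists_multiplier (fun k => gradSymbol L i k * (((stokesEig L k)⁻¹ : ℝ) : ℂ))
      (fun k => by rw [stokesEig_neg, map_mul, Complex.conj_ofReal, gradSymbol_neg])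
      (B := ((2 * Real.pi / L) ^ 2)⁻¹) (fun k => ?_) f
    rw [norm_mul, Complex.norm_real, Real.norm_eq_abs, mul_pow, sq_abs]
    by_cases hk : k = 0
    · rw [hk, stokesEig_zero, inv_zero, zero_pow two_ne_zero, mul_zero]
      have := wavenumber_pos (L := L)
      positivity
    · have hp := stokesEig_pos (L := L) hk
      calc _ ≤ stokesEig L k * (stokesEig L k)⁻¹ ^ 2 :=
            mul_le_mul_of_nonneg_right (norm_gradSymbol_sq_le i k) (sq_nonneg _)
        _ = (stokesEig L k)⁻¹ := by field_simp
        _ ≤ _ := inv_anti₀ (pow_pos wavenumber_pos 2) (stokesEig_ge hk)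
  choose G hG using key
  refine ⟨G, fun k i j => ?_, hG⟩
  rw [hG, h, mul_assoc]
  rfl

section GradientOfInverse

variable {f : Field2 L} {G : Fin 3 → Field2 L}
  (hG : ∀ i k j, fcoef L (G i) k j =
    gradSymbol L i k * (((stokesEig L k)⁻¹ : ℝ) : ℂ) * fcoef L f k j)
include hG

lemma coefSq_gradient (i : Fin 3) (k : Fin 3 → ℤ) :
    coefSq (G i) k = ‖gradSymbol L i k‖ ^ 2 * ((stokesEig L k)⁻¹ ^ 2 * coefSq f k) := by
  rw [coefSq_of_multiplier (hG i), norm_mul, Complex.norm_real, Real.norm_eq_abs, mul_pow, sq_abs,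
    mul_assoc]

lemma stokesEig_sq_mul_coefSq_gradient (hf : f ∈ spaceH L) (i : Fin 3) (k : Fin 3 → ℤ) :
    stokesEig L k ^ 2 * coefSq (G i) k = ‖gradSymbol L i k‖ ^ 2 * coefSq f k := by
  rw [coefSq_gradient hG]
  by_cases hk : k = 0
  · simp [hk, coefSq_zero_of_mem_spaceH hf]
  · have := stokesEig_pos (L := L) hk
    field_simp

/-- `A ∂ᵢ A⁻¹ f = ∂ᵢ f` is square-integrable because `f ∈ V`; this makes Agmon's inequality
applicable to each `∂ᵢ A⁻¹ f`. -/
lemma gradient_mem_stokesDomain (hf : f ∈ spaceV L) (i : Fin 3) : G i ∈ stokesDomain L 1 := by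
  refine ⟨mem_spaceH_of_multiplier (hG i) hf.1, ?_⟩
  have h1 : Summable fun k => stokesEig L k ^ 2 * coefSq (G i) k := by
    refine Summable.of_nonneg_of_le (fun k => mul_nonneg (sq_nonneg _) (coefSq_nonneg _ k))
      (fun k => ?_) (summable_stokesEig_mul_coefSq hf)
    rw [stokesEig_sq_mul_coefSq_gradient hG hf.1]
    exact mul_le_mul_of_nonneg_right (norm_gradSymbol_sq_le i k) (coefSq_nonneg _ k)
  refine h1.congr fun k => ?_
  norm_num
  exact Or.inl rfl

/-- Summed over the directions, the squared symbols of the gradient give exactly the eigenvalue, so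
no dimensional constant is lost. -/
lemma sum_stokesNorm_one_gradient (hf : f ∈ spaceV L) :
    ∑ i, stokesNorm L 1 (G i) ^ 2 = stokesNorm L (1 / 2) f ^ 2 := by
  simp only [stokesNorm_one_sq]
  rw [← Finset.mul_sum, stokesNorm_half_sq, ← Summable.tsum_finsetSum fun i _ =>
    summable_stokesEig_sq_mul_coefSq (gradient_mem_stokesDomain hG hf i)]
  congr 2
  ext k
  simp only [stokesEig_sq_mul_coefSq_gradient hG hf.1]
  rw [← Finset.sum_mul, sum_norm_gradSymbol_sq]

lemma sum_stokesNorm_half_gradient (hf : f ∈ spaceV L) :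
    ∑ i, stokesNorm L (1 / 2) (G i) ^ 2 = ‖f‖ ^ 2 := by
  simp only [stokesNorm_half_sq]
  rw [← Finset.mul_sum, norm_sq_eq_tsum_coefSq, ← Summable.tsum_finsetSum fun i _ =>
    summable_stokesEig_mul_coefSq (stokesDomain_mono (by norm_num)
      (gradient_mem_stokesDomain hG hf i))]
  congr 2
  ext k
  simp only [coefSq_gradient hG]
  rw [← Finset.mul_sum, ← Finset.sum_mul, sum_norm_gradSymbol_sq]
  by_cases hk : k = 0
  · simp [hk, coefSq_zero_of_mem_spaceH hf.1]
  · have := stokesEig_pos (L := L) hk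
    field_simp

/-- The pointwise bound of `∇ A⁻¹ f` from Agmon's inequality. -/
lemma ae_sum_norm_gradient_sq_le {C_A : ℝ} (hA : IsAgmonConstant L C_A) (hf : f ∈ spaceV L) :
    ∀ᵐ x : Box L, ∑ i, ‖G i x‖ ^ 2 ≤ C_A ^ 2 * (‖f‖ * stokesNorm L (1 / 2) f) := by
  have h1 : ∀ i, ∀ᵐ x : Box L, ‖G i x‖ ≤
      C_A * stokesNorm L (1 / 2) (G i) ^ (1 / 2 : ℝ) * stokesNorm L 1 (G i) ^ (1 / 2 : ℝ) :=
    fun i => hA.2 _ (gradient_mem_stokesDomain hG hf i)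
  have hrt : ∀ a : ℝ, 0 ≤ a → (a ^ (1 / 2 : ℝ)) ^ 2 = a := fun a ha => by
    rw [← Real.sqrt_eq_rpow, Real.sq_sqrt ha]
  filter_upwards [ae_all_iff.2 h1] with x hx
  calc ∑ i, ‖G i x‖ ^ 2
      ≤ ∑ i, C_A ^ 2 * (stokesNorm L (1 / 2) (G i) * stokesNorm L 1 (G i)) := by
        refine Finset.sum_le_sum fun i _ => ?_
        have := pow_le_pow_left₀ (norm_nonneg _) (hx i) 2
        rwa [mul_pow, mul_pow, hrt _ (stokesNorm_nonneg _ _), hrt _ (stokesNorm_nonneg _ _),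
          mul_assoc] at this
    _ = C_A ^ 2 * ∑ i, stokesNorm L (1 / 2) (G i) * stokesNorm L 1 (G i) := by
        rw [Finset.mul_sum]
    _ ≤ C_A ^ 2 * (‖f‖ * stokesNorm L (1 / 2) f) := by
        refine mul_le_mul_of_nonneg_left ?_ (sq_nonneg _)
        -- Cauchy-Schwarz over the three directions keeps the Agmon constant unchanged.
        have := Real.sum_mul_le_sqrt_mul_sqrt Finset.univ
          (fun i => stokesNorm L (1 / 2) (G i)) (fun i => stokesNorm L 1 (G i))
        rwa [sum_stokesNorm_half_gradient hG hf, sum_stokesNorm_one_gradient hG hf,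
          Real.sqrt_sq (norm_nonneg _), Real.sqrt_sq (stokesNorm_nonneg _ _)] at this

end GradientOfInverse

end Multipliers

/-! ### The trilinear form with a bounded gradient. -/

section Trilinear

variable {L : ℝ} [hL : Fact (0 < L)] {G : Fin 3 → Field2 L} {D : ℝ}

/-- The operator norm of a matrix is at most its Frobenius norm; Cauchy-Schwarz is used in `j`, then
in `i`. -/
lemma abs_sum_mul_mul_le (hD : 0 ≤ D) (M : Fin 3 → EuclideanSpace ℝ (Fin 3))
    (hM : ∑ i, ‖M i‖ ^ 2 ≤ D ^ 2) (a b : EuclideanSpace ℝ (Fin 3)) :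
    |∑ i, ∑ j, a i * M i j * b j| ≤ D * (‖a‖ * ‖b‖) := by
  have h1 : ∀ i, ∑ j, a i * M i j * b j = a i * inner ℝ (M i) b := by
    intro i
    rw [PiLp.inner_apply, Finset.mul_sum]
    refine Finset.sum_congr rfl fun j _ => ?_
    simp only [RCLike.inner_apply, conj_trivial]
    ring
  simp only [h1]
  calc |∑ i, a i * inner ℝ (M i) b| ≤ ∑ i, |a i| * (‖M i‖ * ‖b‖) := by
        refine (Finset.abs_sum_le_sum_abs _ _).trans (Finset.sum_le_sum fun i _ => ?_)
        rw [abs_mul]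
        exact mul_le_mul_of_nonneg_left (abs_real_inner_le_norm _ _) (abs_nonneg _)
    _ = (∑ i, |a i| * ‖M i‖) * ‖b‖ := by
        rw [Finset.sum_mul]
        exact Finset.sum_congr rfl fun i _ => (mul_assoc _ _ _).symm
    _ ≤ (‖a‖ * D) * ‖b‖ := by
        refine mul_le_mul_of_nonneg_right ?_ (norm_nonneg _)
        refine (Real.sum_mul_le_sqrt_mul_sqrt Finset.univ (fun i => |a i|)
          (fun i => ‖M i‖)).trans ?_
        simp only [sq_abs]
        rw [← norm_sq_eq_sum_sq, Real.sqrt_sq (norm_nonneg _)]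
        exact mul_le_mul_of_nonneg_left (Real.sqrt_le_iff.2 ⟨hD, hM⟩) (norm_nonneg _)
    _ = D * (‖a‖ * ‖b‖) := by ring

/-- The integrand of the trilinear form, polarised. -/
noncomputable def trilinearDensity (G : Fin 3 → Field2 L) (w w' : Field2 L) (x : Box L) : ℝ :=
  ∑ i, ∑ j, w x i * G i x j * w' x j

lemma integrable_norm_mul_norm (w w' : Field2 L) :
    Integrable (fun x : Box L => ‖w x‖ * ‖w' x‖) :=
  (Lp.memLp w).norm.integrable_mul (Lp.memLp w').norm

lemma integral_norm_mul_norm_le (w w' : Field2 L) :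
    ∫ x : Box L, ‖w x‖ * ‖w' x‖ ≤ ‖w‖ * ‖w'‖ := by
  have h2 : ∀ v : Field2 L, (∫ x : Box L, ‖v x‖ ^ (2 : ℝ)) ^ (1 / 2 : ℝ) = ‖v‖ := by
    intro v
    rw [← Real.sqrt_eq_rpow]
    have : ∫ x : Box L, ‖v x‖ ^ (2 : ℝ) = ‖v‖ ^ 2 := by
      rw [← real_inner_self_eq_norm_sq, MeasureTheory.L2.inner_def]
      simp
    rw [this, Real.sqrt_sq (norm_nonneg _)]
  have := integral_mul_norm_le_Lp_mul_Lq (μ := (volume : Measure (Box L))) (f := w) (g := w')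
    Real.HolderConjugate.two_two (by simpa using Lp.memLp w) (by simpa using Lp.memLp w')
  rwa [h2, h2] at this

variable (hD : 0 ≤ D) (hGD : ∀ᵐ x : Box L, ∑ i, ‖G i x‖ ^ 2 ≤ D ^ 2)
include hD hGD

lemma ae_abs_trilinearDensity_le (w w' : Field2 L) :
    ∀ᵐ x : Box L, ‖trilinearDensity G w w' x‖ ≤ D * (‖w x‖ * ‖w' x‖) := by
  filter_upwards [hGD] with x hx
  exact abs_sum_mul_mul_le hD (fun i => G i x) hx _ _

lemma integrable_trilinearDensity (w w' : Field2 L) : Integrable (trilinearDensity G w w') := by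
  refine ((integrable_norm_mul_norm w w').const_mul D).mono' ?_
    (ae_abs_trilinearDensity_le hD hGD w w')
  have hc : ∀ (v : Field2 L) (j : Fin 3),
      AEStronglyMeasurable (fun x : Box L => v x j) := fun v j =>
    (coordCLM j).continuous.comp_aestronglyMeasurable (Lp.aestronglyMeasurable v)
  refine Finset.aestronglyMeasurable_fun_sum _ fun i _ =>
    Finset.aestronglyMeasurable_fun_sum _ fun j _ => ((hc w i).mul (hc (G i) j)).mul (hc w' j)

lemma abs_integral_trilinearDensity_le (w w' : Field2 L) :
    |∫ x : Box L, trilinearDensity G w w' x| ≤ D * (‖w‖ * ‖w'‖) := by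
  refine (norm_integral_le_of_norm_le ((integrable_norm_mul_norm w w').const_mul D)
    (ae_abs_trilinearDensity_le hD hGD w w')).trans ?_
  rw [integral_const_mul]
  exact mul_le_mul_of_nonneg_left (integral_norm_mul_norm_le w w') hD

lemma abs_trilinear_le (w : Field2 L) : |trilinear L w G| ≤ D * ‖w‖ ^ 2 := by
  rw [sq]
  exact abs_integral_trilinearDensity_le hD hGD w w

/-- The trilinear form with a bounded gradient is a continuous quadratic form. -/
lemma continuous_trilinear : Continuous fun w : Field2 L => trilinear L w G := by
  have hi := integrable_trilinearDensity hD hGD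
  -- The form is the diagonal of a bounded bilinear map. Its continuity is what makes `t ↦ trilinear
  -- L (u t) G` measurable.
  let B : Field2 L →ₗ[ℝ] Field2 L →ₗ[ℝ] ℝ := LinearMap.mk₂ ℝ
    (fun w w' => ∫ x : Box L, trilinearDensity G w w' x)
    (fun w₁ w₂ w' => by
      rw [← integral_add (hi _ _) (hi _ _)]
      refine integral_congr_ae ?_
      filter_upwards [Lp.coeFn_add w₁ w₂] with x hx
      simp only [trilinearDensity, hx, Pi.add_apply, PiLp.add_apply, add_mul,
        Finset.sum_add_distrib])
    (fun c w w' => by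
      rw [smul_eq_mul, ← integral_const_mul]
      refine integral_congr_ae ?_
      filter_upwards [Lp.coeFn_smul c w] with x hx
      simp only [trilinearDensity, hx, Pi.smul_apply, PiLp.smul_apply, smul_eq_mul,
        Finset.mul_sum, mul_assoc])
    (fun w w₁ w₂ => by
      rw [← integral_add (hi _ _) (hi _ _)]
      refine integral_congr_ae ?_
      filter_upwards [Lp.coeFn_add w₁ w₂] with x hx
      simp only [trilinearDensity, hx, Pi.add_apply, PiLp.add_apply, mul_add,
        Finset.sum_add_distrib])
    (fun c w w' => by
      rw [smul_eq_mul, ← integral_const_mul]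
      refine integral_congr_ae ?_
      filter_upwards [Lp.coeFn_smul c w'] with x hx
      simp only [trilinearDensity, hx, Pi.smul_apply, PiLp.smul_apply, smul_eq_mul,
        Finset.mul_sum, mul_left_comm])
  let B' := B.mkContinuous₂ D fun w w' => by
    rw [mul_assoc]
    exact abs_integral_trilinearDensity_le hD hGD w w'
  have : (fun w : Field2 L => trilinear L w G) = fun w => B' w w := rfl
  rw [this]
  fun_prop

end Trilinear

/-! ### Elementary properties of the cut-off. -/

section Cutoff

variable {C₀ δ T : ℝ} {η : ℝ → ℝ}

lemma IsTimeCutoff.eq_zero (h : IsTimeCutoff C₀ δ T η) {t : ℝ} (ht : t ∉ Icc 0 T) : η t = 0 :=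
  image_eq_zero_of_notMem_tsupport fun h' => ht (h.supp h')

lemma IsTimeCutoff.deriv_eq_zero (h : IsTimeCutoff C₀ δ T η) {t : ℝ} (ht : t ∉ Icc 0 T) :
    deriv η t = 0 :=
  image_eq_zero_of_notMem_tsupport fun h' => ht (h.supp (tsupport_deriv_subset h'))

lemma IsTimeCutoff.rpow_nonneg (h : IsTimeCutoff C₀ δ T η) (t : ℝ) : 0 ≤ η t ^ δ :=
  Real.rpow_nonneg (h.nonneg t) _

lemma IsTimeCutoff.rpow_le_one (h : IsTimeCutoff C₀ δ T η) (hδ : 0 ≤ δ) (t : ℝ) : η t ^ δ ≤ 1 :=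
  Real.rpow_le_one (h.nonneg t) (h.le_one t) hδ

/-- This puts the terms weighted by `η` under the weight `η^δ` that defines `e₀`. -/
lemma IsTimeCutoff.le_rpow (h : IsTimeCutoff C₀ δ T η) (hδ : 0 ≤ δ) (hδ1 : δ ≤ 1) (t : ℝ) :
    η t ≤ η t ^ δ := by
  simpa using Real.rpow_le_rpow_of_exponent_ge' (h.nonneg t) (h.le_one t) hδ hδ1

lemma IsTimeCutoff.continuous_rpow (h : IsTimeCutoff C₀ δ T η) (hδ : 0 ≤ δ) :
    Continuous fun t => η t ^ δ := h.contDiff.continuous.rpow_const fun _ => Or.inr hδ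

lemma IsTimeCutoff.abs_deriv_le (h : IsTimeCutoff C₀ δ T η) (hδ : 0 ≤ δ) (hC : 0 ≤ C₀ / T) (t : ℝ) :
    |deriv η t| ≤ C₀ / T :=
  (h.deriv_le t).trans (mul_le_of_le_one_right hC (h.rpow_le_one hδ t))

/-- The Cauchy-Schwarz inequality for a weighted integral. -/
lemma sq_integral_mul_le {m y : ℝ → ℝ} {a b : ℝ} (hab : a ≤ b) (hm : ∀ t, 0 ≤ m t)
    (h0 : IntervalIntegrable m volume a b) (h1 : IntervalIntegrable (fun t => m t * y t) volume a b)
    (h2 : IntervalIntegrable (fun t => m t * y t ^ 2) volume a b) :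
    (∫ t in a..b, m t * y t) ^ 2 ≤ (∫ t in a..b, m t) * ∫ t in a..b, m t * y t ^ 2 := by
  -- The quadratic `c ↦ ∫ m (y - c)²` is nonnegative, so its discriminant is not positive; this form
  -- needs no division by `∫ m`.
  have h := discrim_le_zero (a := ∫ t in a..b, m t) (b := -(2 * ∫ t in a..b, m t * y t))
    (c := ∫ t in a..b, m t * y t ^ 2) fun c => by
      have hn : 0 ≤ ∫ t in a..b, m t * (y t - c) ^ 2 :=
        intervalIntegral.integral_nonneg hab fun t _ => mul_nonneg (hm t) (sq_nonneg _)
      have e : ∫ t in a..b, m t * (y t - c) ^ 2 = (c * c) * (∫ t in a..b, m t) -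
          (2 * c) * (∫ t in a..b, m t * y t) + ∫ t in a..b, m t * y t ^ 2 := by
        rw [← intervalIntegral.integral_const_mul, ← intervalIntegral.integral_const_mul,
          ← intervalIntegral.integral_sub (h0.const_mul _) (h1.const_mul _),
          ← intervalIntegral.integral_add ((h0.const_mul _).sub (h1.const_mul _)) h2]
        congr 1
        ext t
        ring
      rw [e] at hn
      linarith
  rw [discrim] at h
  linarith

end Cutoff

/-! ### The two estimates for the solution: tested equation and energy flux. -/

section Estimates

variable {L : ℝ} [hL : Fact (0 < L)] {ν C₀ C_A δ T : ℝ} {f : Field2 L} {u : ℝ → Field2 L}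
  {η : ℝ → ℝ}

lemma IsLerayHopf.intervalIntegrable_mul_norm (hu : IsLerayHopf L ν f (Ici 0) u) (hT : 0 ≤ T)
    {m : ℝ → ℝ} (hm : Continuous m) :
    IntervalIntegrable (fun t => m t * ‖u t‖) volume 0 T :=
  ((intervalIntegrable_iff_integrableOn_Icc_of_le hT).2
    (hu.integrableOn_norm Icc_subset_Ici_self (by simp))).continuousOn_mul hm.continuousOn

lemma IsLerayHopf.intervalIntegrable_mul_norm_sq (hu : IsLerayHopf L ν f (Ici 0) u) (hT : 0 ≤ T)
    {m : ℝ → ℝ} (hm : Continuous m) :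
    IntervalIntegrable (fun t => m t * ‖u t‖ ^ 2) volume 0 T :=
  ((intervalIntegrable_iff_integrableOn_Icc_of_le hT).2
    (hu.integrableOn_norm_sq Icc_subset_Ici_self (by simp))).continuousOn_mul hm.continuousOn

lemma IsLerayHopf.intervalIntegrable_mul_inner (hu : IsLerayHopf L ν f (Ici 0) u) (hT : 0 ≤ T)
    {m : ℝ → ℝ} (hm : Continuous m) (v : Field2 L) :
    IntervalIntegrable (fun t => m t * inner ℝ v (u t)) volume 0 T := by
  refine ContinuousOn.intervalIntegrable ?_
  rw [uIcc_of_le hT]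
  exact hm.continuousOn.mul ((hu.continuousOn_inner v).mono Icc_subset_Ici_self)

lemma IsLerayHopf.sq_integral_norm_le (hu : IsLerayHopf L ν f (Ici 0) u) (hT : 0 ≤ T)
    (hη : IsTimeCutoff C₀ δ T η) (hδ : 0 ≤ δ) :
    (∫ t in (0 : ℝ)..T, η t ^ δ * ‖u t‖) ^ 2 ≤ T * ∫ t in (0 : ℝ)..T, η t ^ δ * ‖u t‖ ^ 2 := by
  have hc := hη.continuous_rpow hδ
  refine (sq_integral_mul_le hT hη.rpow_nonneg (hc.intervalIntegrable _ _)
    (hu.intervalIntegrable_mul_norm hT hc) (hu.intervalIntegrable_mul_norm_sq hT hc)).trans ?_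
  refine mul_le_mul_of_nonneg_right ?_ (intervalIntegral.integral_nonneg hT fun t _ =>
    mul_nonneg (hη.rpow_nonneg t) (sq_nonneg _))
  have := intervalIntegral.integral_mono_on hT (hc.intervalIntegrable 0 T)
    (intervalIntegrable_const (c := (1 : ℝ)) (μ := volume)) fun t _ => hη.rpow_le_one hδ t
  simpa using this

/-- Testing the equation with `A⁻¹ f`. -/
lemma IsLerayHopf.integral_cutoff_mul_force_le (hu : IsLerayHopf L ν f (Ici 0) u) (hν : 0 < ν)
    (hT : 0 < T) (hη : IsTimeCutoff C₀ δ T η) (hδ : 0 ≤ δ) (hδ1 : δ ≤ 1)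
    (hA : IsAgmonConstant L C_A) (hf : f ∈ spaceV L) {D : ℝ} (hD : 0 ≤ D)
    (hD2 : D ^ 2 = C_A ^ 2 * (‖f‖ * stokesNorm L (1 / 2) f)) :
    (∫ t in (0 : ℝ)..T, η t) * stokesNorm L (-(1 / 2)) f ^ 2 ≤
      (C₀ / T * stokesNorm L (-1) f + ν * ‖f‖) * (∫ t in (0 : ℝ)..T, η t ^ δ * ‖u t‖) +
        D * ∫ t in (0 : ℝ)..T, η t ^ δ * ‖u t‖ ^ 2 := by
  obtain ⟨v, hv⟩ := exists_isStokesInverse f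
  obtain ⟨G, hvG, hG⟩ := hv.exists_gradient
  have hGD : ∀ᵐ x : Box L, ∑ i, ‖G i x‖ ^ 2 ≤ D ^ 2 := by
    rw [hD2]
    exact ae_sum_norm_gradient_sq_le hG hA hf
  have htri : IntegrableOn (fun t => trilinear L (u t) G) (Icc 0 (T + 1)) :=
    hu.integrableOn_comp (continuous_trilinear hD hGD) (C := D)
      (fun w => (abs_trilinear_le hD hGD w).trans
        (mul_le_mul_of_nonneg_left (by linarith) hD)) Icc_subset_Ici_self (by simp)
  have hci : ∀ w : Field2 L, IntegrableOn (fun t => inner ℝ w (u t)) (Icc 0 (T + 1)) := fun w =>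
    ((hu.continuousOn_inner w).mono Icc_subset_Ici_self).integrableOn_compact isCompact_Icc
  have hp : IntegrableOn (fun t => inner ℝ (u t) v) (Icc 0 (T + 1)) := by
    simp only [real_inner_comm v]
    exact hci v
  have hst : ∀ t ∈ Icc 0 (T + 1), stokesInner L (1 / 2) (u t) v = inner ℝ f (u t) :=
    fun t ht => hv.stokesInner_eq (hu.mem_H t ht.1)
  have hq' : IntegrableOn (fun t => ν * inner ℝ f (u t) - trilinear L (u t) G - inner ℝ f v)
      (Icc 0 (T + 1)) :=
    (((hci f).const_mul ν).sub htri).sub (integrableOn_const (by simp))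
  have hq : IntegrableOn (fun t => ν * stokesInner L (1 / 2) (u t) v - trilinear L (u t) G -
      inner ℝ f v) (Icc 0 (T + 1)) := by
    refine hq'.congr_fun (fun t ht => ?_) measurableSet_Icc
    simp only [hst t ht]
  -- The cut-off is only `C¹` and may be supported up to `t = 0`, so it is not itself an admissible
  -- test function.
  have hw := weak_form_of_contDiff_one hη.contDiff (fun t ht => hη.eq_zero ht) hp hq
    fun φ h1 h2 h3 => hu.weak_form v (hv.mem_spaceV hf) G hvG φ h1 h2 (by rwa [interior_Ici])
  rw [integral_eq_intervalIntegral_of_support hT.le (fun t ht => by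
    rw [hη.eq_zero ht, hη.deriv_eq_zero ht, zero_mul, zero_mul, neg_zero, add_zero])] at hw
  have hsub : Icc 0 T ⊆ Icc 0 (T + 1) := Icc_subset_Icc_right (by linarith)
  have hηc := hη.contDiff.continuous
  have hηd : Continuous (deriv η) := hη.contDiff.continuous_deriv (by norm_num)
  have hδc := hη.continuous_rpow hδ
  have hI1 : IntervalIntegrable (fun t => -(deriv η t * inner ℝ v (u t))) volume 0 T :=
    (hu.intervalIntegrable_mul_inner hT.le hηd v).neg
  have hI2 : IntervalIntegrable (fun t => η t * (ν * inner ℝ f (u t) - trilinear L (u t) G))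
      volume 0 T := by
    refine IntervalIntegrable.continuousOn_mul ?_ hηc.continuousOn
    rw [intervalIntegrable_iff_integrableOn_Icc_of_le hT.le]
    exact IntegrableOn.mono_set (Integrable.sub ((hci f).const_mul ν) htri) hsub
  -- The force term `(f, A⁻¹ f)` is constant in time and is isolated on the left.
  have e1 : (∫ t in (0 : ℝ)..T, η t) * stokesNorm L (-(1 / 2)) f ^ 2 =
      ∫ t in (0 : ℝ)..T, (-(deriv η t * inner ℝ v (u t)) +
        η t * (ν * inner ℝ f (u t) - trilinear L (u t) G)) := by
    rw [← hv.inner_eq, ← sub_eq_zero, ← neg_eq_zero, neg_sub,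
      ← intervalIntegral.integral_mul_const, ← intervalIntegral.integral_sub (hI1.add hI2)
        ((hηc.intervalIntegrable _ _).mul_const _)]
    refine Eq.trans ?_ hw
    refine intervalIntegral.integral_congr fun t ht => ?_
    rw [uIcc_of_le hT.le] at ht
    simp only [hst t (hsub ht), real_inner_comm v]
    ring
  rw [e1, ← hv.norm_eq, ← intervalIntegral.integral_const_mul,
    ← intervalIntegral.integral_const_mul, ← intervalIntegral.integral_add
      ((hu.intervalIntegrable_mul_norm hT.le hδc).const_mul _)
      ((hu.intervalIntegrable_mul_norm_sq hT.le hδc).const_mul _)]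
  refine intervalIntegral.integral_mono_on hT.le (hI1.add hI2)
    (((hu.intervalIntegrable_mul_norm hT.le hδc).const_mul _).add
      ((hu.intervalIntegrable_mul_norm_sq hT.le hδc).const_mul _)) fun t _ => ?_
  have b1 : -(deriv η t * inner ℝ v (u t)) ≤ C₀ / T * η t ^ δ * (‖v‖ * ‖u t‖) := by
    refine (neg_le_abs _).trans ?_
    rw [abs_mul]
    exact mul_le_mul (hη.deriv_le t) (abs_real_inner_le_norm _ _) (abs_nonneg _)
      ((abs_nonneg _).trans (hη.deriv_le t))
  have b2 : η t * (ν * inner ℝ f (u t) - trilinear L (u t) G) ≤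
      η t ^ δ * (ν * (‖f‖ * ‖u t‖) + D * ‖u t‖ ^ 2) := by
    have h1 := mul_le_mul_of_nonneg_left (real_inner_le_norm f (u t)) hν.le
    have h2 := neg_le_of_abs_le (abs_trilinear_le hD hGD (u t))
    calc _ ≤ η t * (ν * (‖f‖ * ‖u t‖) + D * ‖u t‖ ^ 2) :=
          mul_le_mul_of_nonneg_left (by linarith) (hη.nonneg t)
      _ ≤ _ := mul_le_mul_of_nonneg_right (hη.le_rpow hδ hδ1 t) (by positivity)
  linarith

lemma IsLerayHopf.integral_energy_flux_le (hu : IsLerayHopf L ν f (Ici 0) u)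
    (hT : 0 < T) (hη : IsTimeCutoff C₀ δ T η) (hδ : 0 ≤ δ) (hδ1 : δ ≤ 1) :
    (∫ t in (0 : ℝ)..T, deriv η t * (‖u t‖ ^ 2 / 2)) +
        (∫ t in (0 : ℝ)..T, η t * inner ℝ f (u t)) ≤
      C₀ / T * (∫ t in (0 : ℝ)..T, η t ^ δ * (‖u t‖ ^ 2 / 2)) +
        ‖f‖ * ∫ t in (0 : ℝ)..T, η t ^ δ * ‖u t‖ := by
  have hηc := hη.contDiff.continuous
  have hηd : Continuous (deriv η) := hη.contDiff.continuous_deriv (by norm_num)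
  have hδc := hη.continuous_rpow hδ
  have hhalf : ∀ {m : ℝ → ℝ}, Continuous m →
      IntervalIntegrable (fun t => m t * (‖u t‖ ^ 2 / 2)) volume 0 T := fun hm => by
    simp only [← mul_div_assoc]
    exact (hu.intervalIntegrable_mul_norm_sq hT.le hm).div_const 2
  rw [← intervalIntegral.integral_const_mul, ← intervalIntegral.integral_const_mul]
  refine add_le_add ?_ ?_
  · refine intervalIntegral.integral_mono_on hT.le (hhalf hηd) ((hhalf hδc).const_mul _)
      fun t _ => ?_
    rw [← mul_assoc]
    exact mul_le_mul_of_nonneg_right ((le_abs_self _).trans (hη.deriv_le t)) (by positivity)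
  · refine intervalIntegral.integral_mono_on hT.le (hu.intervalIntegrable_mul_inner hT.le hηc f)
      ((hu.intervalIntegrable_mul_norm hT.le hδc).const_mul _) fun t _ => ?_
    calc η t * inner ℝ f (u t) ≤ η t * (‖f‖ * ‖u t‖) :=
          mul_le_mul_of_nonneg_left (real_inner_le_norm _ _) (hη.nonneg t)
      _ ≤ η t ^ δ * (‖f‖ * ‖u t‖) :=
          mul_le_mul_of_nonneg_right (hη.le_rpow hδ hδ1 t) (by positivity)
      _ = ‖f‖ * (η t ^ δ * ‖u t‖) := by ring

/-- Membership in the domain matters: a divergent `tsum` has value `0`, and the norm would vanish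
for a nonzero field. -/
lemma stokesNorm_pos {s : ℝ} (hf : f ∈ stokesDomain L s) (h0 : f ≠ 0) : 0 < stokesNorm L s f := by
  refine (stokesNorm_nonneg s f).lt_of_ne' fun h => h0 (field_ext_fcoef (w := 0) fun k j => ?_)
  have h1 : ∑' k, stokesEig L k ^ (2 * s) * coefSq f k = 0 := by
    have := stokesNorm_sq s f
    rw [h, zero_pow two_ne_zero] at this
    exact (mul_eq_zero.1 this.symm).resolve_left (side_cube_pos (L := L)).ne'
  have hz : coefSq (0 : Field2 L) k = 0 := by
    have h2 : HasSum (fun k => coefSq (0 : Field2 L) k) 0 := by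
      have := (summable_coefSq (0 : Field2 L)).hasSum
      have e := norm_sq_eq_tsum_coefSq (0 : Field2 L)
      rw [norm_zero, zero_pow two_ne_zero] at e
      rwa [(mul_eq_zero.1 e.symm).resolve_left (side_cube_pos (L := L)).ne'] at this
    exact congrFun ((hasSum_zero_iff_of_nonneg (coefSq_nonneg _)).1 h2) k
  have hfk : coefSq f k = 0 := by
    by_cases hk : k = 0
    · rw [hk, coefSq_zero_of_mem_spaceH hf.1]
    · have h3 : HasSum (fun k => stokesEig L k ^ (2 * s) * coefSq f k) 0 := by
        rw [← h1]
        exact hf.2.hasSum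
      have h4 := congrFun ((hasSum_zero_iff_of_nonneg fun k =>
        mul_nonneg (Real.rpow_nonneg (stokesEig_nonneg k) _) (coefSq_nonneg f k)).1 h3) k
      exact (mul_eq_zero.1 h4).resolve_left (Real.rpow_pos_of_pos (stokesEig_pos hk) _).ne'
  have hzero : ∀ v : Field2 L, coefSq v k = 0 → fcoef L v k j = 0 := fun v hv => by
    have := norm_sq_fcoef_le_coefSq v k j
    rw [hv] at this
    exact norm_eq_zero.1 (sq_eq_zero_iff.1 (le_antisymm this (sq_nonneg _)))
  rw [hzero f hfk, hzero 0 hz]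

end Estimates

/-! ### Algebra of the scaling relations. -/

section Scaling

/-- The lower bound of the energy from the tested equation. -/
lemma ratio_le_of_tested_equation {c N D g s a : ℝ} (hD : 0 < D) (hc : 0 < c * N)
    (hmain : c * N ≤ g * a + D * s) (ha : a ^ 2 ≤ s)
    (hσ : 2 * g ^ 2 ≤ c * N * D) : c * N / (2 * D) ≤ s := by
  -- If `s` is below the threshold, the quadratic term takes less than half of `c N`, so `g a > c N
  -- / 2`; squaring and using `a² ≤ s` contradicts `hσ`.
  by_contra! h
  rw [lt_div_iff₀ (by positivity)] at h
  have h1 : c * N / 2 < g * a := by linarith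
  have h2 : (c * N / 2) ^ 2 < (g * a) ^ 2 := pow_lt_pow_left₀ h1 (by positivity) two_ne_zero
  have h3 : (g * a) ^ 2 ≤ g ^ 2 * s := by
    rw [mul_pow]
    exact mul_le_mul_of_nonneg_left ha (sq_nonneg _)
  have hs : 0 ≤ s := (sq_nonneg a).trans ha
  have h4 : g ^ 2 * s ≤ c * N * D / 2 * s := mul_le_mul_of_nonneg_right (by linarith) hs
  have h5 : c * N * (s * (2 * D)) < c * N * (c * N) := mul_lt_mul_of_pos_left h hc
  linarith

/-- The upper bound of the dissipation rate, once the energy flux of the cut-off is absorbed. -/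
lemma dissipation_le_of_flux_bound {C₀ T ν R m F s a e ε : ℝ} (hν : 0 < ν) (hT : 0 < T)
    (hR : 0 < R) (hm : 0 < m) (hF : 0 ≤ F) (hC : 0 < C₀)
    (he : e = s / (2 * m ^ 2)) (ha : a ^ 2 ≤ s)
    (hs : s ≤ (F * (4 * R ^ 2) / (ν * Real.pi ^ 2)) ^ 2)
    (hTC : 2 * C₀ / Real.pi ^ 2 * (R ^ 2 / ν) ≤ T)
    (hε : ε ≤ C₀ / T * e + F / m ^ 2 * a) :
    ε ≤ 2 * Real.sqrt 2 * (F / m) * Real.sqrt e := by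
  have hs0 : 0 ≤ s := (sq_nonneg a).trans ha
  have he0 : 0 ≤ e := by rw [he]; positivity
  have h2 : Real.sqrt 2 ^ 2 = 2 := Real.sq_sqrt (by norm_num)
  have h2pos : 0 < Real.sqrt 2 := by positivity
  set x := Real.sqrt e with hx
  have hx0 : 0 ≤ x := Real.sqrt_nonneg _
  have hxe : x ^ 2 = e := Real.sq_sqrt he0
  have hsx : s = (Real.sqrt 2 * m * x) ^ 2 := by
    rw [mul_pow, mul_pow, h2, hxe, he]
    field_simp
  have ha' : a ≤ Real.sqrt 2 * m * x := by
    rw [hsx] at ha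
    exact le_of_sq_le_sq ha (by positivity)
  have hb : Real.sqrt 2 * m * x ≤ F * (4 * R ^ 2) / (ν * Real.pi ^ 2) := by
    rw [hsx] at hs
    exact le_of_sq_le_sq hs (by positivity)
  have hpi := Real.pi_pos
  -- The attractor bound on `x` and the lower bound on `T` fit exactly here. Both terms of `hε` then
  -- cost at most `√2 (F/m) x`, whence the factor `2 √2`.
  have h3 : C₀ / T * x ≤ Real.sqrt 2 * (F / m) := by
    rw [div_mul_eq_mul_div, div_le_iff₀ hT]
    have h4 : C₀ * (Real.sqrt 2 * m * x) ≤ 2 * F * T := by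
      calc C₀ * (Real.sqrt 2 * m * x) ≤ C₀ * (F * (4 * R ^ 2) / (ν * Real.pi ^ 2)) :=
            mul_le_mul_of_nonneg_left hb hC.le
        _ = 2 * F * (2 * C₀ / Real.pi ^ 2 * (R ^ 2 / ν)) := by field_simp; ring
        _ ≤ 2 * F * T := mul_le_mul_of_nonneg_left hTC (by positivity)
    have h5 : Real.sqrt 2 * (F / m) * T = (Real.sqrt 2 * (F * T)) / m := by ring
    rw [h5, le_div_iff₀ hm]
    have h6 : Real.sqrt 2 * (C₀ * x * m) ≤ Real.sqrt 2 * (Real.sqrt 2 * (F * T)) := by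
      calc Real.sqrt 2 * (C₀ * x * m) = C₀ * (Real.sqrt 2 * m * x) := by ring
        _ ≤ 2 * F * T := h4
        _ = Real.sqrt 2 ^ 2 * (F * T) := by rw [h2]; ring
        _ = _ := by ring
    exact le_of_mul_le_mul_left h6 h2pos
  have h7 : C₀ / T * e ≤ Real.sqrt 2 * (F / m) * x := by
    rw [← hxe, sq, ← mul_assoc]
    exact mul_le_mul_of_nonneg_right h3 hx0
  have h8 : F / m ^ 2 * a ≤ Real.sqrt 2 * (F / m) * x := by
    calc F / m ^ 2 * a ≤ F / m ^ 2 * (Real.sqrt 2 * m * x) :=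
          mul_le_mul_of_nonneg_left ha' (by positivity)
      _ = _ := by field_simp
  linarith

/-- The scaling relations, in terms of roots of the quantities. -/
lemma scaling_of_roots {b κ τ φ r x ε : ℝ} (hb : 0 < b) (hκ : 0 < κ) (hτ : 0 < τ) (hφ : 0 < φ)
    (hr : 0 < r) (hx : 0 ≤ x) (hlow : τ ^ 2 * (φ ^ 2 / r ^ 2) ≤ x ^ 2)
    (hup : ε ≤ b ^ 2 * (φ ^ 2 / r ^ 6) * x) (hK : κ ^ 2 * (x ^ 3 / r ^ 4) ≤ ε) :
    κ ^ 3 * τ ^ 3 / b * (φ ^ 2 / r ^ 6) * x ≤ ε ∧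
      x ^ 2 ≤ b ^ 2 / κ ^ 2 * (φ ^ 2 / r ^ 2) ∧
      κ ^ 2 * τ ^ 3 * (φ ^ 3 / r ^ 7) ≤ ε ∧
      ε ≤ b ^ 5 / (κ ^ 3 * τ ^ 2) * (φ ^ 3 / r ^ 7) := by
  have h1 : τ * (φ / r) ≤ x := by
    refine le_of_sq_le_sq ?_ hx
    rwa [mul_pow, div_pow]
  have hx0 : 0 < x := lt_of_lt_of_le (by positivity) h1
  have h2 : x ^ 2 ≤ b ^ 2 / κ ^ 2 * (φ ^ 2 / r ^ 2) := by
    have h := hK.trans hup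
    have e1 : κ ^ 2 * (x ^ 3 / r ^ 4) = (κ ^ 2 / r ^ 4 * x) * x ^ 2 := by ring
    have e2 : b ^ 2 * (φ ^ 2 / r ^ 6) * x =
        (κ ^ 2 / r ^ 4 * x) * (b ^ 2 / κ ^ 2 * (φ ^ 2 / r ^ 2)) := by
      field_simp
    rw [e1, e2] at h
    exact le_of_mul_le_mul_left h (by positivity)
  have h3 : x ≤ b / κ * (φ / r) := by
    refine le_of_sq_le_sq ?_ (by positivity)
    rwa [mul_pow, div_pow, div_pow]
  -- The lower and upper bounds on `x` must be compatible; this comparison of constants yields the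
  -- first and the last inequality.
  have h4 : κ * τ ≤ b := by
    have h := h1.trans h3
    have h' := le_of_mul_le_mul_right h (by positivity)
    rw [le_div_iff₀ hκ] at h'
    linarith
  refine ⟨?_, h2, ?_, ?_⟩
  · refine le_trans ?_ hK
    have e1 : κ ^ 3 * τ ^ 3 / b * (φ ^ 2 / r ^ 6) * x =
        κ ^ 2 / r ^ 4 * x * ((κ * τ / b) * (τ ^ 2 * (φ ^ 2 / r ^ 2))) := by
      field_simp
    have e2 : κ ^ 2 * (x ^ 3 / r ^ 4) = κ ^ 2 / r ^ 4 * x * x ^ 2 := by ring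
    rw [e1, e2]
    refine mul_le_mul_of_nonneg_left ?_ (by positivity)
    refine le_trans ?_ hlow
    exact mul_le_of_le_one_left (by positivity) ((div_le_one hb).2 h4)
  · refine le_trans ?_ hK
    have h5 := pow_le_pow_left₀ (by positivity) h1 3
    have e1 : κ ^ 2 * τ ^ 3 * (φ ^ 3 / r ^ 7) = κ ^ 2 * ((τ * (φ / r)) ^ 3 / r ^ 4) := by
      field_simp
    rw [e1]
    gcongr
  · refine hup.trans ?_
    calc b ^ 2 * (φ ^ 2 / r ^ 6) * x ≤ b ^ 2 * (φ ^ 2 / r ^ 6) * (b / κ * (φ / r)) :=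
          mul_le_mul_of_nonneg_left h3 (by positivity)
      _ = b ^ 3 / (κ ^ 3 * τ ^ 2) * (φ ^ 3 / r ^ 7) * (κ * τ) ^ 2 := by
        field_simp
      _ ≤ b ^ 3 / (κ ^ 3 * τ ^ 2) * (φ ^ 3 / r ^ 7) * b ^ 2 := by gcongr
      _ = b ^ 5 / (κ ^ 3 * τ ^ 2) * (φ ^ 3 / r ^ 7) := by ring

lemma rpow_nat_div_eq {x : ℝ} (hx : 0 ≤ x) (m n : ℕ) (q : ℝ) (hq : q = (m : ℝ) / n) :
    x ^ q = (x ^ (1 / (n : ℝ))) ^ m := by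
  rw [← Real.rpow_natCast, ← Real.rpow_mul hx, hq]
  congr 1
  ring

/-- With `R = r⁴`, the other quantities written as squares and `b = 8^(1/4)`, every fractional power
becomes a monomial: `2 √2 = b²` and `8^(5/4) = b⁵`. -/
lemma scaling_relations {F R ν K e ε θ Gr : ℝ} (hF : 0 < F) (hR : 0 < R) (hν : 0 < ν) (hK : 0 < K)
    (hθ : 0 < θ) (he : 0 ≤ e) (hGr : Gr = F / (ν ^ 2 * R ^ (-(3 / 2) : ℝ)))
    (hlow : θ * (F / R ^ (1 / 2 : ℝ)) ≤ e)
    (hup : ε ≤ 2 * Real.sqrt 2 * (F / R ^ (3 / 2 : ℝ)) * e ^ (1 / 2 : ℝ))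
    (hKe : K * (e ^ (3 / 2 : ℝ) / R) ≤ ε) :
    (K ^ (3 / 2 : ℝ) * θ ^ (3 / 2 : ℝ) / 8 ^ (1 / 4 : ℝ) *
          (F / R ^ (3 / 2 : ℝ)) * e ^ (1 / 2 : ℝ) ≤ ε ∧
        ε ≤ 2 * Real.sqrt 2 * (F / R ^ (3 / 2 : ℝ)) * e ^ (1 / 2 : ℝ)) ∧
      (θ * (F / R ^ (1 / 2 : ℝ)) ≤ e ∧
        e ≤ 2 * Real.sqrt 2 / K * (F / R ^ (1 / 2 : ℝ))) ∧
      (K * θ ^ (3 / 2 : ℝ) * (F ^ (3 / 2 : ℝ) / R ^ (7 / 4 : ℝ)) ≤ ε ∧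
        ε ≤ 8 ^ (5 / 4 : ℝ) / (K ^ (3 / 2 : ℝ) * θ) *
          (F ^ (3 / 2 : ℝ) / R ^ (7 / 4 : ℝ))) ∧
      (θ * (ν ^ 2 / R ^ 2) * Gr ≤ e ∧
        e ≤ 2 * Real.sqrt 2 / K * (ν ^ 2 / R ^ 2) * Gr) ∧
      (K * θ ^ (3 / 2 : ℝ) * (ν ^ 3 / R ^ 4) * Gr ^ (3 / 2 : ℝ) ≤ ε ∧
        ε ≤ 8 ^ (5 / 4 : ℝ) / (K ^ (3 / 2 : ℝ) * θ) * (ν ^ 3 / R ^ 4) *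
          Gr ^ (3 / 2 : ℝ)) := by
  obtain ⟨r, hr, rfl⟩ : ∃ r : ℝ, 0 < r ∧ R = r ^ 4 :=
    ⟨R ^ (1 / (4 : ℕ) : ℝ), by positivity, by
      rw [← rpow_nat_div_eq hR.le 4 4 1 (by norm_num), Real.rpow_one]⟩
  have hsq : ∀ y : ℝ, 0 ≤ y → ∃ z : ℝ, 0 ≤ z ∧ y = z ^ 2 := fun y hy =>
    ⟨Real.sqrt y, Real.sqrt_nonneg y, (Real.sq_sqrt hy).symm⟩
  have hsq' : ∀ y : ℝ, 0 < y → ∃ z : ℝ, 0 < z ∧ y = z ^ 2 := fun y hy =>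
    ⟨Real.sqrt y, Real.sqrt_pos.2 hy, (Real.sq_sqrt hy.le).symm⟩
  obtain ⟨φ, hφ, rfl⟩ := hsq' F hF
  obtain ⟨κ, hκ, rfl⟩ := hsq' K hK
  obtain ⟨τ, hτ, rfl⟩ := hsq' θ hθ
  obtain ⟨x, hx, rfl⟩ := hsq e he
  set b : ℝ := 8 ^ (1 / 4 : ℝ) with hb
  have hb0 : 0 < b := by positivity
  have pw : ∀ {y : ℝ} (_ : 0 ≤ y) (n m : ℕ) (q : ℝ), q * n = m → (y ^ n) ^ q = y ^ m := by
    intro y hy n m q hq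
    rw [← Real.rpow_natCast, ← Real.rpow_mul hy, mul_comm, hq, Real.rpow_natCast]
  have h32 : ∀ {y : ℝ}, 0 ≤ y → (y ^ 2) ^ (3 / 2 : ℝ) = y ^ 3 := fun hy =>
    pw hy 2 3 _ (by norm_num)
  have h12 : (x ^ 2) ^ (1 / 2 : ℝ) = x := by rw [pw hx 2 1 _ (by norm_num), pow_one]
  have r12 : (r ^ 4) ^ (1 / 2 : ℝ) = r ^ 2 := pw hr.le 4 2 _ (by norm_num)
  have r32 : (r ^ 4) ^ (3 / 2 : ℝ) = r ^ 6 := pw hr.le 4 6 _ (by norm_num)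
  have r74 : (r ^ 4) ^ (7 / 4 : ℝ) = r ^ 7 := pw hr.le 4 7 _ (by norm_num)
  have b5 : (8 : ℝ) ^ (5 / 4 : ℝ) = b ^ 5 := by
    rw [hb, ← Real.rpow_natCast, ← Real.rpow_mul (by norm_num)]
    norm_num
  have b2 : 2 * Real.sqrt 2 = b ^ 2 := by
    have : (0 : ℝ) ≤ 2 * Real.sqrt 2 := by positivity
    rw [← sq_eq_sq₀ this (by positivity), mul_pow, Real.sq_sqrt (by norm_num), hb,
      ← Real.rpow_natCast (8 ^ (1 / 4 : ℝ)), ← Real.rpow_mul (by norm_num), ← Real.rpow_natCast,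
      ← Real.rpow_natCast, ← Real.rpow_mul (by norm_num)]
    norm_num
  have hG : Gr = (φ ^ 2 * r ^ 6) / ν ^ 2 := by
    rw [hGr, Real.rpow_neg (by positivity), r32]
    field_simp
  have hG32 : Gr ^ (3 / 2 : ℝ) = φ ^ 3 * r ^ 9 / ν ^ 3 := by
    have : Gr = (φ * r ^ 3 / ν) ^ 2 := by
      rw [hG]
      field_simp
    rw [this, h32 (by positivity)]
    field_simp
  rw [h32 hx] at hKe
  rw [r12] at hlow
  rw [b2, r32, h12] at hup
  obtain ⟨g1, g2, g3, g4⟩ := scaling_of_roots hb0 hκ hτ hφ hr hx hlow hup hKe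
  have e1 : ∀ c : ℝ, c * (ν ^ 2 / (r ^ 4) ^ 2) * Gr = c * (φ ^ 2 / r ^ 2) := fun c => by
    rw [hG]
    field_simp
  have e2 : ∀ c : ℝ, c * (ν ^ 3 / (r ^ 4) ^ 4) * Gr ^ (3 / 2 : ℝ) = c * (φ ^ 3 / r ^ 7) :=
    fun c => by
      rw [hG32]
      field_simp
  rw [e1, e1, e2, e2, h32 hκ.le, h32 hτ.le, h32 hφ.le, r12, r32, r74, h12, b5, b2]
  exact ⟨⟨g1, hup⟩, ⟨hlow, g2⟩, ⟨g3, g4⟩, ⟨hlow, g2⟩, g3, g4⟩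

end Scaling

/-! ### The factors `σ_f` and `θ_f`, and the assembly. -/

/-- The linear coefficient is `γ_f ν ‖f‖`; after clearing denominators, `σ_f ≤ ‖f‖` is the smallness
condition of `ratio_le_of_tested_equation`. -/
lemma ratio_le_of_sigmaFactor_le {L : ℝ} [hL : Fact (0 < L)] {ν C₀ C_A T D : ℝ} {η : ℝ → ℝ}
    {f : Field2 L} (hν : 0 < ν) (hA : 0 < C_A) (hη : 0 < cutoffMean T η) (hF : 0 < ‖f‖)
    (hH : 0 < stokesNorm L (1 / 2) f) (hN : 0 < stokesNorm L (-(1 / 2)) f)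
    (hD : D = C_A * ‖f‖ ^ (1 / 2 : ℝ) * stokesNorm L (1 / 2) f ^ (1 / 2 : ℝ))
    (hσ : sigmaFactor L ν C₀ C_A T η f ≤ ‖f‖) :
    2 * (C₀ / T * stokesNorm L (-1) f + ν * ‖f‖) ^ 2 ≤
      cutoffMean T η * stokesNorm L (-(1 / 2)) f ^ 2 * D := by
  have hγ : C₀ / T * stokesNorm L (-1) f + ν * ‖f‖ = gammaFactor L ν C₀ T f * ν * ‖f‖ := by
    rw [gammaFactor, ← div_div]
    field_simp
  have hp : 0 < ‖f‖ ^ (1 / 2 : ℝ) := Real.rpow_pos_of_pos hF _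
  have hq : 0 < stokesNorm L (1 / 2) f ^ (1 / 2 : ℝ) := Real.rpow_pos_of_pos hH _
  have hp2 : (‖f‖ ^ (1 / 2 : ℝ)) ^ 2 = ‖f‖ := by
    rw [← Real.sqrt_eq_rpow, Real.sq_sqrt hF.le]
  rw [hγ, hD]
  rw [sigmaFactor] at hσ
  set p := ‖f‖ ^ (1 / 2 : ℝ)
  set q := stokesNorm L (1 / 2) f ^ (1 / 2 : ℝ)
  set N := stokesNorm L (-(1 / 2)) f
  set c := cutoffMean T η
  set γ := gammaFactor L ν C₀ T f
  have h : 2 * γ ^ 2 * ν ^ 2 * p * ‖f‖ ^ 2 ≤ ‖f‖ * (c * C_A * q * N ^ 2) := by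
    rw [← div_le_iff₀ (by positivity)]
    refine le_of_eq_of_le ?_ hσ
    field_simp
  have h2 := mul_le_mul_of_nonneg_left h hp.le
  have e1 : p * (2 * γ ^ 2 * ν ^ 2 * p * ‖f‖ ^ 2) = ‖f‖ * (2 * (γ * ν * ‖f‖) ^ 2) := by
    calc _ = p ^ 2 * (2 * γ ^ 2 * ν ^ 2 * ‖f‖ ^ 2) := by ring
      _ = _ := by
        rw [hp2]
        ring
  have e2 : p * (‖f‖ * (c * C_A * q * N ^ 2)) = ‖f‖ * (c * N ^ 2 * (C_A * p * q)) := by ring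
  rw [e1, e2] at h2
  exact le_of_mul_le_mul_left h2 hF

/-- `θ_f` is the threshold `c N / (2 D)` of `ratio_le_of_tested_equation`, with `N = ‖A^(-1/2) f‖²`,
in the units of `e₀ = s / (2 R₀³)`. -/
lemma thetaFactor_mul_eq {L : ℝ} [hL : Fact (0 < L)] {R₀ C_A T D : ℝ} {η : ℝ → ℝ}
    {f : Field2 L} (hR : 0 < R₀) (hF : 0 < ‖f‖)
    (hD : D = C_A * ‖f‖ ^ (1 / 2 : ℝ) * stokesNorm L (1 / 2) f ^ (1 / 2 : ℝ)) :
    thetaFactor L R₀ C_A T η f * (‖f‖ / R₀ ^ (1 / 2 : ℝ)) =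
      cutoffMean T η * stokesNorm L (-(1 / 2)) f ^ 2 / (2 * D) / (2 * R₀ ^ 3) := by
  have hp : 0 < ‖f‖ ^ (1 / 2 : ℝ) := Real.rpow_pos_of_pos hF _
  have e1 : ‖f‖ ^ (3 / 2 : ℝ) = ‖f‖ * ‖f‖ ^ (1 / 2 : ℝ) := by
    rw [← Real.rpow_one_add' hF.le (by norm_num)]
    norm_num
  have e2 : R₀ ^ 3 = R₀ ^ (5 / 2 : ℝ) * R₀ ^ (1 / 2 : ℝ) := by
    rw [← Real.rpow_add hR, ← Real.rpow_natCast]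
    norm_num
  rw [thetaFactor, hD, e1, e2]
  field_simp
  ring

theorem theorem5 :
    (∃ C_A : ℝ, ∀ (L : ℝ) [Fact (0 < L)], IsAgmonConstant L C_A) ∧
    ∀ (L R₀ ν C₀ C_A δ T K : ℝ) [Fact (0 < L)] (f : Field2 L) (u : ℝ → Field2 L) (η : ℝ → ℝ)
      (e₀ ε₀ θ Gr : ℝ),
      L = 4 * R₀ → 0 < ν → 0 < C₀ → 1 / 2 < δ → δ < 1 →
      IsAgmonConstant L C_A →
      f ∈ spaceV L → f ≠ 0 →
      IsTimeCutoff C₀ δ T η → 0 < cutoffMean T η →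
      IsLerayHopf L ν f (Ici 0) u →
      (∀ t ∈ Icc 0 T, u t ∈ weakAttractor L ν f) →
      sigmaFactor L ν C₀ C_A T η f ≤ ‖f‖ →
      2 * C₀ / Real.pi ^ 2 * (R₀ ^ 2 / ν) ≤ T →
      e₀ = meanEnergy L R₀ δ T η u →
      ε₀ = meanDissipation L ν R₀ T f η u →
      θ = thetaFactor L R₀ C_A T η f →
      Gr = grashof L ν R₀ f →
      0 < K →
      K * (e₀ ^ (3 / 2 : ℝ) / R₀) ≤ ε₀ →
      0 ≤ anomalousDissipation L ν R₀ T f η u ∧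
      (K ^ (3 / 2 : ℝ) * θ ^ (3 / 2 : ℝ) / 8 ^ (1 / 4 : ℝ) *
          (‖f‖ / R₀ ^ (3 / 2 : ℝ)) * e₀ ^ (1 / 2 : ℝ) ≤ ε₀ ∧
        ε₀ ≤ 2 * Real.sqrt 2 * (‖f‖ / R₀ ^ (3 / 2 : ℝ)) * e₀ ^ (1 / 2 : ℝ)) ∧
      (θ * (‖f‖ / R₀ ^ (1 / 2 : ℝ)) ≤ e₀ ∧
        e₀ ≤ 2 * Real.sqrt 2 / K * (‖f‖ / R₀ ^ (1 / 2 : ℝ))) ∧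
      (K * θ ^ (3 / 2 : ℝ) * (‖f‖ ^ (3 / 2 : ℝ) / R₀ ^ (7 / 4 : ℝ)) ≤ ε₀ ∧
        ε₀ ≤ 8 ^ (5 / 4 : ℝ) / (K ^ (3 / 2 : ℝ) * θ) *
          (‖f‖ ^ (3 / 2 : ℝ) / R₀ ^ (7 / 4 : ℝ))) ∧
      (θ * (ν ^ 2 / R₀ ^ 2) * Gr ≤ e₀ ∧
        e₀ ≤ 2 * Real.sqrt 2 / K * (ν ^ 2 / R₀ ^ 2) * Gr) ∧
      (K * θ ^ (3 / 2 : ℝ) * (ν ^ 3 / R₀ ^ 4) * Gr ^ (3 / 2 : ℝ) ≤ ε₀ ∧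
        ε₀ ≤ 8 ^ (5 / 4 : ℝ) / (K ^ (3 / 2 : ℝ) * θ) * (ν ^ 3 / R₀ ^ 4) *
          Gr ^ (3 / 2 : ℝ)) := by
  refine ⟨⟨2, fun L _ => isAgmonConstant_two L⟩, ?_⟩
  intro L R₀ ν C₀ C_A δ T K hL f u η e₀ ε₀ θ Gr hLR hν hC₀ hδ hδ1 hA hf hf0 hη hcη hu hatt hσ hTC
    he₀ hε₀ hθ hGr hK hKe
  have hR : 0 < R₀ := by
    have := hL.out
    linarith
  have hpi := Real.pi_pos
  have hT : 0 < T := lt_of_lt_of_le (by positivity) hTC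
  have hδ0 : 0 ≤ δ := by linarith
  have hF : 0 < ‖f‖ := norm_pos_iff.2 hf0
  have hH : 0 < stokesNorm L (1 / 2) f := stokesNorm_pos hf hf0
  have hN : 0 < stokesNorm L (-(1 / 2)) f :=
    stokesNorm_pos (stokesDomain_mono (by norm_num : (-(1 / 2) : ℝ) ≤ 1 / 2) hf) hf0
  have hδc := hη.continuous_rpow hδ0
  have hflux : ∀ t, |deriv η t| ≤ C₀ / T := hη.abs_deriv_le hδ0 (by positivity)
  set E := ∫ t in (0 : ℝ)..T, η t ^ δ * ‖u t‖ ^ 2 with hE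
  set A := ∫ t in (0 : ℝ)..T, η t ^ δ * ‖u t‖ with hAdef
  have hEhalf : ∫ t in (0 : ℝ)..T, η t ^ δ * (‖u t‖ ^ 2 / 2) = E / 2 := by
    simp only [← mul_div_assoc, intervalIntegral.integral_div, hE]
  have hA2 : (A / T) ^ 2 ≤ E / T := by
    rw [div_pow, div_le_div_iff₀ (by positivity) hT]
    have := mul_le_mul_of_nonneg_right (hu.sq_integral_norm_le hT.le hη hδ0) hT.le
    linarith
  have he : e₀ = E / T / (2 * R₀ ^ 3) := by
    rw [he₀, meanEnergy, hEhalf]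
    field_simp
  have he0 : 0 ≤ e₀ := by
    rw [he]
    have : 0 ≤ E / T := (sq_nonneg _).trans hA2
    positivity
  have hanom : 0 ≤ anomalousDissipation L ν R₀ T f η u := by
    have h := hu.localized_energy_inequality hT hη.contDiff hη.nonneg
      (fun t ht => hη.eq_zero ht) hflux
    rw [anomalousDissipation, viscousDissipation, ← mul_add, mul_assoc _ ν, ← mul_sub]
    exact mul_nonneg (by positivity) (by linarith)
  have hs : E / T ≤ (‖f‖ * (4 * R₀ ^ 2) / (ν * Real.pi ^ 2)) ^ 2 := by
    have hb : ∀ t ∈ Icc 0 T, ‖u t‖ ≤ ‖f‖ * (4 * R₀ ^ 2) / (ν * Real.pi ^ 2) := fun t ht => by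
      refine (norm_le_of_mem_weakAttractor hν (hatt t ht)).trans_eq ?_
      -- The first eigenvalue for `L = 4 R₀`.
      have hlam : (2 * Real.pi / L) ^ 2 = Real.pi ^ 2 / (4 * R₀ ^ 2) := by
        rw [hLR]
        field_simp
        norm_num
      rw [hlam]
      field_simp
    rw [div_le_iff₀ hT]
    have := intervalIntegral.integral_mono_on hT.le (hu.intervalIntegrable_mul_norm_sq hT.le hδc)
      (intervalIntegrable_const (c := (‖f‖ * (4 * R₀ ^ 2) / (ν * Real.pi ^ 2)) ^ 2)
        (μ := volume)) fun t ht =>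
        (mul_le_of_le_one_left (sq_nonneg _) (hη.rpow_le_one hδ0 t)).trans
          (pow_le_pow_left₀ (norm_nonneg _) (hb t ht) 2)
    rw [intervalIntegral.integral_const, smul_eq_mul, sub_zero] at this
    linarith
  have hm2 : (R₀ ^ (3 / 2 : ℝ)) ^ 2 = R₀ ^ 3 := by
    rw [← Real.rpow_natCast, ← Real.rpow_mul hR.le, ← Real.rpow_natCast]
    norm_num
  have hup : ε₀ ≤ 2 * Real.sqrt 2 * (‖f‖ / R₀ ^ (3 / 2 : ℝ)) * e₀ ^ (1 / 2 : ℝ) := by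
    rw [← Real.sqrt_eq_rpow]
    refine dissipation_le_of_flux_bound (m := R₀ ^ (3 / 2 : ℝ)) hν hT hR (by positivity) hF.le hC₀
      (he.trans (by rw [hm2])) hA2 hs hTC ?_
    have h := hu.integral_energy_flux_le hT hη hδ0 hδ1.le
    rw [hEhalf, ← hAdef] at h
    -- The viscous part cancels in the sum with the anomalous part, so `ε₀` needs no bound on
    -- gradients.
    have e1 : ε₀ = 1 / T * (1 / R₀ ^ 3) * ((∫ t in (0 : ℝ)..T, deriv η t * (‖u t‖ ^ 2 / 2)) +
        ∫ t in (0 : ℝ)..T, η t * inner ℝ f (u t)) := by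
      rw [hε₀, meanDissipation, anomalousDissipation]
      ring
    rw [e1, hm2, he]
    refine (mul_le_mul_of_nonneg_left h (by positivity)).trans_eq ?_
    field_simp
  set D := C_A * ‖f‖ ^ (1 / 2 : ℝ) * stokesNorm L (1 / 2) f ^ (1 / 2 : ℝ) with hD
  have hD0 : 0 < D := mul_pos (mul_pos hA.1 (Real.rpow_pos_of_pos hF _))
    (Real.rpow_pos_of_pos hH _)
  have hD2 : D ^ 2 = C_A ^ 2 * (‖f‖ * stokesNorm L (1 / 2) f) := by
    rw [hD, mul_pow, mul_pow, ← Real.sqrt_eq_rpow, ← Real.sqrt_eq_rpow, Real.sq_sqrt hF.le,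
      Real.sq_sqrt hH.le, mul_assoc]
  have htheta := thetaFactor_mul_eq (T := T) (η := η) hR hF hD
  rw [← hθ] at htheta
  have hθ0 : 0 < θ := by
    have h1 : 0 < θ * (‖f‖ / R₀ ^ (1 / 2 : ℝ)) := by
      rw [htheta]
      positivity
    exact pos_of_mul_pos_left h1 (by positivity)
  have hlow : θ * (‖f‖ / R₀ ^ (1 / 2 : ℝ)) ≤ e₀ := by
    rw [htheta, he]
    refine div_le_div_of_nonneg_right ?_ (by positivity)
    refine ratio_le_of_tested_equation (g := C₀ / T * stokesNorm L (-1) f + ν * ‖f‖)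
      (a := A / T) hD0 (by positivity) ?_ hA2 ?_
    · have h := hu.integral_cutoff_mul_force_le hν hT hη hδ0 hδ1.le hA hf hD0.le hD2
      have := mul_le_mul_of_nonneg_left h (by positivity : 0 ≤ 1 / T)
      rw [cutoffMean]
      calc _ = 1 / T * ((∫ t in (0 : ℝ)..T, η t) * stokesNorm L (-(1 / 2)) f ^ 2) := by ring
        _ ≤ _ := this
        _ = _ := by ring
    · exact ratio_le_of_sigmaFactor_le hν hA.1 hcη hF hH hN hD hσ
  exact ⟨hanom, scaling_relations hF hR hν hK hθ0 he0 hGr hlow hup hKe⟩
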